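/- **Setting.** Let $f:\{0,1\}^n\to\{0,1\}$; all inputs are uniform on $\{0,1\}^n$ and $\log$ is to base $2$. Put $\mathrm{Inf}_i[f]=\Pr_x[f(x)\ne f(x^{\oplus i})]$ and $I[f]=\sum_i \mathrm{Inf}_i[f]$; for a partial assignment $\pi$, $f_\pi$ is the restricted function, viewed as a function on $\{0,1\}^n$ that ignores the fixed coordinates. Let $c\in\mathbb R_{\ge 0}^n$ be a cost vector. *Online model with unit investment $\beta>0$.* The algorithm knows $f$ but neither the input $x$ nor $c$. It keeps an investment vector $\theta$, initially $0$; in each step it may increase one coordinate $\theta_i$ by $\beta$, and then $x_i$ is revealed to it if $\theta_i\ge c_i$. Its cost is $\|\theta\|_1$ when it halts. An offline algorithm is a decision tree; its cost on $x$ is the sum of $c_i$ over the variables it queries on $x$. The error of an algorithm is the probability (over uniform $x$ and its own random bits) that it does not halt with output $f(x)$, and avg-cost is its expected cost. Let $\mathrm{opt}=\mathrm{opt}^{\mathrm{avg}}_\varepsilon(f,c)$ be the infimum of the average cost over all deterministic (offline or online) algorithms with error at most $\varepsilon$. *$\mathrm{IPRR}(f,\varepsilon,B)$.* Start with $\theta=0$,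 $\pi=\emptyset$. Repeat: let $i^*$ be the first index that maximizes $\mathrm{Inf}_i[f_\pi]/\theta_i$ (which is $\infty$ if $\theta_i=0<\mathrm{Inf}_i[f_\pi]$, and $0$ if $\mathrm{Inf}_i[f_\pi]=0$). If this ratio is $<\varepsilon/B$, halt and output $\mathbf 1\{\mathbb E_x[f_\pi(x)]\ge 1/2\}$. Otherwise invest $\beta$ in $x_{i^*}$, and if it is revealed to be $b$, add $x_{i^*}\mapsto b$ to $\pi$. *$\textsc{Online-Query}(f,\varepsilon)$, with constant $K$.* For $i=1,2,\dots$: let $B_i=2^i$ and $m_i=\lceil \frac{K}{\varepsilon}\log\frac{i}{\varepsilon}\rceil$; draw $m_i$ fresh uniform inputs, simulate $\mathrm{IPRR}(f,\varepsilon,B_i)$ on each, and let $T_i$ be the fraction of them on which its output differs from $f$. If $T_i\le 3\varepsilon$, run $\mathrm{IPRR}(f,\varepsilon,B_i)$ on the unknown input $x$, output its result and halt. Investments are shared between all these calls: Online-Query really invests a unit in $x_j$ only if $x_j$ is not yet revealed and the current call's investment in $x_j$ exceeds the investment in $x_j$ made so far. The current call is told that variable $j$ is revealed exactly when its own investment in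 $x_j$ reaches the level at which $x_j$ was really revealed, and it is then given the $j$-th bit of the input on which it is run. **Theorem.** There is $K_0>0$ such that for every $K\ge K_0$ the following holds for $\textsc{Online-Query}$ with constant $K$, where the constants below may depend on $K$. 1. There is a constant $C$ such that for all $n$, $f:\{0,1\}^n\to\{0,1\}$, $c\in\mathbb R^n_{\ge0}$, $\varepsilon\in(0,\tfrac12]$ and $\beta>0$, $\textsc{Online-Query}(f,\varepsilon)$ with unit investment $\beta$ has error at most $C\varepsilon$. 2. For every $a>0$ there is a constant $C$ such that for all $n,f,c,\varepsilon,\beta$ as above with $\mathrm{opt}\ge a$, $$\text{avg-cost}_c(\textsc{Online-Query})\le \beta n+\mathrm{opt}\cdot \frac{C}{\varepsilon^{3}}\log\frac{\max\{1,\log \mathrm{opt}\}}{\varepsilon}\cdot\sum_{i=1}^n \mathrm{Inf}_i[f]\Bigl(1+\ln\frac1{\mathrm{Inf}_i[f]}\Bigr),$$ where terms with $\mathrm{Inf}_i[f]=0$ are $0$, and, if $n\ge 2$, also $$\text{avg-cost}_c(\textsc{Online-Query})\le \beta n+\mathrm{opt}\cdot \frac{C\, I[f]\log n}{\varepsilon^{3}}\log\frac{\max\{1,\log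 \mathrm{opt}\}}{\varepsilon}.$$ -/

import Mathlib

namespace PricedQuery

open scoped ENNReal

/-- The Boolean cube `{0,1}^n`. -/
abbrev Cube (n : ℕ) : Type := Fin n → Bool

open Classical in
/-- `Pr[p(x)]` for `x` uniform on the cube. -/
noncomputable def unifPr {n : ℕ} (p : Cube n → Prop) : ℝ :=
  ((Finset.univ.filter p).card : ℝ) / 2 ^ n

/-- `Inf_i[f] = Pr[f(x) ≠ f(x^{⊕ i})]`. -/
noncomputable def influence {n : ℕ} (f : Cube n → Bool) (i : Fin n) : ℝ :=
  unifPr fun x => f x ≠ f (Function.update x i (!x i))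

/-- The total influence `I[f]`. -/
noncomputable def totalInfluence {n : ℕ} (f : Cube n → Bool) : ℝ :=
  ∑ i, influence f i

/-- The restriction `f_π`, regarded as a function on the whole cube that ignores the coordinates
fixed by the partial assignment `π`. -/
def restrict {n : ℕ} (f : Cube n → Bool) (π : Fin n → Option Bool) : Cube n → Bool :=
  fun x => f fun i => (π i).getD (x i)

/-! ### Offline query algorithms -/

/-- A decision tree over `n` Boolean variables. -/
inductive DecisionTree (n : ℕ) : Type
  | leaf (b : Bool) : DecisionTree n
  | query (i : Fin n) (next : Bool → DecisionTree n) : DecisionTree n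

/-- The output of the tree on input `x`. -/
def DecisionTree.eval {n : ℕ} : DecisionTree n → Cube n → Bool
  | .leaf b, _ => b
  | .query i next, x => (next (x i)).eval x

/-- The set of variables queried on input `x`. -/
def DecisionTree.queried {n : ℕ} : DecisionTree n → Cube n → Finset (Fin n)
  | .leaf _, _ => ∅
  | .query i next, x => insert i ((next (x i)).queried x)

/-- The total cost incurred on input `x`: each revealed variable `x_i` costs `c_i`. -/
noncomputable def DecisionTree.cost {n : ℕ} (T : DecisionTree n) (c : Fin n → ℝ) (x : Cube n) :
    ℝ≥0∞ :=
  ENNReal.ofReal (∑ i ∈ T.queried x, c i)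

noncomputable def DecisionTree.error {n : ℕ} (T : DecisionTree n) (f : Cube n → Bool) : ℝ :=
  unifPr fun x => T.eval x ≠ f x

noncomputable def DecisionTree.avgCost {n : ℕ} (T : DecisionTree n) (c : Fin n → ℝ) : ℝ≥0∞ :=
  (∑ x : Cube n, T.cost c x) / 2 ^ n

/-! ### The online priced query model -/

/-- What an online algorithm does in one step, with internal states in `S`: halt with an output
bit; invest one unit in a variable and continue according to the response (`some b` if the variable
is revealed to be `b`, and `none` if it is not revealed); or compute internally. -/
inductive Action (n : ℕ) (S : Type) : Type
  | output (b : Bool) : Action n S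
  | invest (i : Fin n) (next : Option Bool → S) : Action n S
  | think (s : S) : Action n S

/-- A deterministic online algorithm. It has no access to the costs or to the input except through
the responses to its investments. -/
structure OnlineAlg (n : ℕ) where
  State : Type
  init : State
  step : State → Action n State

namespace OnlineAlg

variable {n : ℕ}

/-- One step of `A` with unit investment `β` against the cost vector `c` and the input `x`. The
second component counts the units invested so far in each variable, so that the cumulative
investment in `x_i` is `θ_i = β * u i`. After an investment in `x_i`, this bit is revealed if
`θ_i ≥ c_i`. -/
noncomputable def advance (A : OnlineAlg n) (β : ℝ) (c : Fin n → ℝ) (x : Cube n)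
    (p : A.State × (Fin n → ℕ)) : A.State × (Fin n → ℕ) :=
  match A.step p.1 with
  | .output _ => p
  | .invest i next =>
      let u := Function.update p.2 i (p.2 i + 1)
      (next (if c i ≤ β * u i then some (x i) else none), u)
  | .think s => (s, p.2)

/-- The configuration after `t` steps. -/
noncomputable def run (A : OnlineAlg n) (β : ℝ) (c : Fin n → ℝ) (x : Cube n) (t : ℕ) :
    A.State × (Fin n → ℕ) :=
  (A.advance β c x)^[t] (A.init, 0)

/-- `A` halts with output `b`. -/
def Outputs (A : OnlineAlg n) (β : ℝ) (c : Fin n → ℝ) (x : Cube n) (b : Bool) : Prop :=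
  ∃ t, A.step (A.run β c x t).1 = .output b

/-- The total cost `‖θ‖₁`. It is nondecreasing in time and constant after halting, so the supremum is
its value at halting. -/
noncomputable def cost (A : OnlineAlg n) (β : ℝ) (c : Fin n → ℝ) (x : Cube n) : ℝ≥0∞ :=
  ⨆ t, ENNReal.ofReal (∑ i, β * ((A.run β c x t).2 i : ℝ))

/-- Failure to halt counts as an error. -/
noncomputable def error (A : OnlineAlg n) (β : ℝ) (c : Fin n → ℝ) (f : Cube n → Bool) : ℝ :=
  unifPr fun x => ¬ A.Outputs β c x (f x)

noncomputable def avgCost (A : OnlineAlg n) (β : ℝ) (c : Fin n → ℝ) : ℝ≥0∞ :=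
  (∑ x : Cube n, A.cost β c x) / 2 ^ n

end OnlineAlg

/-- The benchmark `opt^avg_ε(f, c)`: the infimum of the expected cost over all `ε`-error query
algorithms for `f`, offline (with `c` known, these are the decision trees) or online (with any unit
investment). It is finite, since the tree that queries every variable has no error. -/
noncomputable def optAvg {n : ℕ} (f : Cube n → Bool) (c : Fin n → ℝ) (ε : ℝ) : ℝ :=
  ((⨅ (T : DecisionTree n) (_ : T.error f ≤ ε), T.avgCost c) ⊓
    (⨅ (A : OnlineAlg n) (β : ℝ) (_ : 0 < β) (_ : A.error β c f ≤ ε), A.avgCost β c)).toReal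

/-! ### Randomized online algorithms

A randomized online algorithm is a family of deterministic ones, indexed by a random seed. -/

section Randomized

variable {n : ℕ} {Ω : Type} [MeasurableSpace Ω]

/-- The probability, over the seed and a uniform input, of not halting with output `f(x)`. -/
noncomputable def randError (P : MeasureTheory.Measure Ω) (A : Ω → OnlineAlg n) (β : ℝ)
    (c : Fin n → ℝ) (f : Cube n → Bool) : ℝ≥0∞ :=
  (∑ x : Cube n, P {ω | ¬ (A ω).Outputs β c x (f x)}) / 2 ^ n

/-- The expected cost over the seed and a uniform input. -/
noncomputable def randAvgCost (P : MeasureTheory.Measure Ω) (A : Ω → OnlineAlg n) (β : ℝ)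
    (c : Fin n → ℝ) : ℝ≥0∞ :=
  (∑ x : Cube n, ∫⁻ ω, (A ω).cost β c x ∂P) / 2 ^ n

end Randomized

/-! ### The algorithm IPRR -/

/-- The data kept by IPRR: the number of units invested in each variable and the restriction given
by the revealed variables. -/
structure IPRRState (n : ℕ) where
  units : Fin n → ℕ
  π : Fin n → Option Bool

/-- The initial state `θ = 0`, `π = ∅`. -/
def IPRRState.start (n : ℕ) : IPRRState n := ⟨fun _ => 0, fun _ => none⟩

/-- The ratio `Inf_i[f_π] / θ_i` in `[0, ∞]`. The conventions of `ℝ≥0∞` make it `∞` if `θ_i = 0` and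
`Inf_i[f_π] > 0`, and `0` if `Inf_i[f_π] = 0`. -/
noncomputable def iprrRatio {n : ℕ} (f : Cube n → Bool) (β : ℝ) (s : IPRRState n) (i : Fin n) :
    ℝ≥0∞ :=
  ENNReal.ofReal (influence (restrict f s.π) i) / ENNReal.ofReal (β * s.units i)

/-- The bit `1{E[f_π] ≥ 1/2}`. -/
noncomputable def roundedMean {n : ℕ} (f : Cube n → Bool) (π : Fin n → Option Bool) : Bool :=
  decide ((1 : ℝ) / 2 ≤ unifPr fun x => restrict f π x = true)

/-- One step of `IPRR(f, ε, B)` with unit investment `β`. The index `i` is the first one that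
maximizes the ratio; the case `none` occurs only for `n = 0`. -/
noncomputable def iprrStep {n : ℕ} (f : Cube n → Bool) (ε B β : ℝ) (s : IPRRState n) :
    Action n (IPRRState n) :=
  match (List.finRange n).argmax (iprrRatio f β s) with
  | none => .output (roundedMean f s.π)
  | some i =>
      if iprrRatio f β s i < ENNReal.ofReal (ε / B) then .output (roundedMean f s.π)
      else .invest i fun r =>
        { units := Function.update s.units i (s.units i + 1)
          π := match r with
            | none => s.π
            | some b => Function.update s.π i (some b) }

/-- `IPRR(f, ε, B)` as an online algorithm. -/
noncomputable def iprr {n : ℕ} (f : Cube n → Bool) (ε B β : ℝ) : OnlineAlg n where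
  State := IPRRState n
  init := IPRRState.start n
  step := iprrStep f ε B β

/-! ### The algorithm Online-Query -/

/-- The random bits of Online-Query: `ω (i, ℓ)` is the sample numbered `ℓ` of round `i`. -/
abbrev Seed (n : ℕ) : Type := ℕ × ℕ → Cube n

/-- The samples are independent and uniform on the cube. -/
noncomputable def seedMeasure (n : ℕ) : MeasureTheory.Measure (Seed n) :=
  MeasureTheory.Measure.infinitePi fun _ : ℕ × ℕ => (PMF.uniformOfFintype (Cube n)).toMeasure

/-- The number of samples `m_i = ⌈(K / ε) log₂ (i / ε)⌉` of round `i`. -/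
noncomputable def sampleCount (K ε : ℝ) (i : ℕ) : ℕ :=
  ⌈K / ε * Real.logb 2 (i / ε)⌉₊

/-- The data kept by Online-Query. -/
structure OQState (n : ℕ) where
  /-- the number of units actually invested in each variable -/
  outer : Fin n → ℕ
  /-- the bits of the unknown input that have been revealed -/
  known : Fin n → Option Bool
  /-- the current round `i`, with the guess `B_i = 2 ^ i` -/
  round : ℕ
  /-- the number of simulations of this round that are complete -/
  done : ℕ
  /-- the number of these that returned a wrong value -/
  wrong : ℕ
  /-- whether IPRR is now being run on the unknown input rather than on a sample -/
  final : Bool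
  /-- the state of the current call to IPRR -/
  inner : IPRRState n

/-- One step of Online-Query. It advances the current call to `IPRR(f, ε, 2 ^ i)`.

When that call invests in `x_j`, raising its own number of units in `x_j` to `v`:
* if `x_j` has been observed, then it was revealed exactly when the actual investment reached its
  present value `outer j`, and the call is shown its bit if and only if `v` reaches that value;
* if `x_j` has not been observed and `v ≤ outer j`, then nothing is revealed;
* otherwise one more unit is actually invested in `x_j`, and the call is shown its bit if and only
  if `x_j` is revealed.

The bit shown is the one of the sample, or the one of the unknown input in the final call.

When that call returns, Online-Query outputs the returned bit if this was the final call. Otherwise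
it goes on to the next sample; after the last sample of the round, it starts the final call if the
empirical error is at most `3 ε`, and the next round if not. -/
noncomputable def oqStep {n : ℕ} (f : Cube n → Bool) (ε β K : ℝ) (ω : Seed n) (s : OQState n) :
    Action n (OQState n) :=
  let sample : Cube n := ω (s.round, s.done)
  match iprrStep f ε (2 ^ s.round) β s.inner with
  | .output b =>
      if s.final then .output b
      else
        let done' := s.done + 1
        let wrong' := s.wrong + if b ≠ f sample then 1 else 0
        let m := sampleCount K ε s.round
        if done' < m then
          .think { s with done := done', wrong := wrong', inner := IPRRState.start n }
        else if (wrong' : ℝ) / m ≤ 3 * ε then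
          .think { s with done := done', wrong := wrong', final := true, inner := IPRRState.start n }
        else
          .think { s with round := s.round + 1, done := 0, wrong := 0, inner := IPRRState.start n }
  | .think t => .think { s with inner := t }
  | .invest j next =>
      let v := s.inner.units j + 1
      let shown : Bool → Bool := fun b => if s.final then b else sample j
      match s.known j with
      | some b =>
          .think { s with inner := next (if s.outer j ≤ v then some (shown b) else none) }
      | none =>
          if v ≤ s.outer j then .think { s with inner := next none }
          else .invest j fun r =>
            { s with
              outer := Function.update s.outer j (s.outer j + 1)
              known := Function.update s.known j r
              inner := next (r.map shown) }

/-- `Online-Query(f, ε)` with unit investment `β`, where `K` is the constant in the number of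
samples. -/
noncomputable def onlineQuery {n : ℕ} (f : Cube n → Bool) (ε β K : ℝ) (ω : Seed n) :
    OnlineAlg n where
  State := OQState n
  init :=
    { outer := fun _ => 0
      known := fun _ => none
      round := 1
      done := 0
      wrong := 0
      final := false
      inner := IPRRState.start n }
  step := oqStep f ε β K ω

/-- The factor `log (log opt / ε)`, with base-2 logarithms, where `log opt` is replaced by `1` if
`opt < 2`. -/
noncomputable def logFactor (opt ε : ℝ) : ℝ :=
  Real.logb 2 (max 1 (Real.logb 2 opt) / ε)

end PricedQuery

open PricedQuery

namespace PricedQuery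

open scoped ENNReal

/-! ### Averages over the cube -/

/-! Error of one call. When IPRR halts, each unrevealed variable satisfies Inf_i[f_π] ≤ (ε/B)·θ_i ≤
(ε/B)·c_i. For any decision tree T, a hybrid argument in the style of
O'Donnell–Saks–Schramm–Servedio (`DecisionTree.mean_ne_le`) shows that f_π is close to a constant:
the distance is at most the error of T on the subcube plus Σ_i Pr[T queries i]·Inf_i[f_π], hence at
most that error plus (ε/B) times the cost of T there. Averaging over the leaves of IPRR, which
partition the cube, bounds the error of IPRR by ε + (ε/B)·opt (`iprr_error_le`). This is at most 2ε
once B ≥ opt. Online algorithms do not lower opt, since trees simulate them (`optAvg_eq`).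

Cost of one call. IPRR invests in x_j only while θ_j ≤ (B/ε)·Inf_j[f_π], so its investment in x_j is
at most one unit more than (B/ε)·max_t Inf_j[f_{π_t}]. Along a run the influence is a
supermartingale: a martingale until x_j is revealed, then 0. Doob's inequality and integration of
tails give an expected maximum of at most Inf_j(1 + ln(1/Inf_j)) (`mean_maxInf_le`).

The doubling search. Investments are shared, so the real investment in x_j is at most one unit plus
the sum of these bounds over all calls (`oq_cost_le`). By Chernoff bounds, a round of error at most
2ε fails its test with probability at most 1/8, and a round of error at least 12ε passes with
probability at most ε/i². Hence the output error is at most 12ε + Σ_i ε/i²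
(`randError_onlineQuery_le`). For the cost, let i₀ be a round with opt ≤ 2^{i₀} = O(opt). Round i >
i₀ is reached with probability at most 8^{-(i-i₀)}, while 2^i and the bound used for the sample
count each grow by a factor 2 per round, so the sum over rounds is of the order of its term at i₀
(`tsum_rounds_le`). The indicator of reaching a round is replaced by a product of exponential
weights of the samples of earlier rounds, which is independent of the samples of the current round.

The resulting bound has only ε⁻². The total influence form uses the third factor 1/ε, because opt >
0 only forces I[f] > ε (`lt_totalInfluence_of_optAvg_pos`). -/

/-- The expectation of `g` under the uniform distribution on the cube. -/
noncomputable def mean {n : ℕ} (g : Cube n → ℝ) : ℝ := (∑ x, g x) / 2 ^ n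

open Classical in
/-- The `0`-`1` indicator of a proposition. -/
noncomputable def ind (p : Prop) : ℝ := if p then 1 else 0

lemma ind_of_true {p : Prop} (h : p) : ind p = 1 := if_pos h
lemma ind_of_false {p : Prop} (h : ¬ p) : ind p = 0 := if_neg h

lemma ind_nonneg (p : Prop) : 0 ≤ ind p := by
  unfold ind; split_ifs <;> norm_num

lemma ind_le_one (p : Prop) : ind p ≤ 1 := by
  unfold ind; split_ifs <;> norm_num

lemma ind_mono {p q : Prop} (h : p → q) : ind p ≤ ind q := by
  by_cases hp : p
  · rw [ind_of_true hp, ind_of_true (h hp)]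
  · rw [ind_of_false hp]; exact ind_nonneg q

lemma ind_congr {p q : Prop} (h : p ↔ q) : ind p = ind q := by rw [h]

lemma ind_le_add {p q r : Prop} (h : p → q ∨ r) : ind p ≤ ind q + ind r := by
  by_cases hp : p
  · rw [ind_of_true hp]
    rcases h hp with hq | hr
    · rw [ind_of_true hq]; linarith [ind_nonneg r]
    · rw [ind_of_true hr]; linarith [ind_nonneg q]
  · rw [ind_of_false hp]; linarith [ind_nonneg q, ind_nonneg r]

section Mean

variable {n : ℕ}

lemma unifPr_eq_mean (p : Cube n → Prop) : unifPr p = mean fun x => ind (p x) := by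
  classical
  unfold unifPr mean ind
  congr 1
  rw [Finset.card_filter]
  push_cast
  exact Finset.sum_congr rfl fun x _ => by congr

lemma mean_mono {g h : Cube n → ℝ} (H : ∀ x, g x ≤ h x) : mean g ≤ mean h := by
  unfold mean
  gcongr with x
  exact H x

lemma mean_congr {g h : Cube n → ℝ} (H : ∀ x, g x = h x) : mean g = mean h :=
  congrArg mean (funext H)

lemma mean_const (a : ℝ) : mean (fun _ : Cube n => a) = a := by
  simp [mean]

lemma mean_add (g h : Cube n → ℝ) : mean (fun x => g x + h x) = mean g + mean h := by
  simp [mean, Finset.sum_add_distrib, add_div]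

lemma mean_const_mul (a : ℝ) (g : Cube n → ℝ) : mean (fun x => a * g x) = a * mean g := by
  simp [mean, ← Finset.mul_sum, mul_div_assoc]

lemma mean_mul_const (a : ℝ) (g : Cube n → ℝ) : mean (fun x => g x * a) = mean g * a := by
  simp_rw [mul_comm _ a]; exact mean_const_mul a g

lemma mean_sum {ι : Type*} (s : Finset ι) (g : ι → Cube n → ℝ) :
    mean (fun x => ∑ i ∈ s, g i x) = ∑ i ∈ s, mean (g i) := by
  simp only [mean]
  rw [Finset.sum_comm, Finset.sum_div]

lemma mean_nonneg {g : Cube n → ℝ} (H : ∀ x, 0 ≤ g x) : 0 ≤ mean g := by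
  rw [← mean_const (n := n) 0]; exact mean_mono H

lemma mean_le_of_le {g : Cube n → ℝ} {a : ℝ} (H : ∀ x, g x ≤ a) : mean g ≤ a := by
  rw [← mean_const (n := n) a]; exact mean_mono H

lemma unifPr_nonneg (p : Cube n → Prop) : 0 ≤ unifPr p := by
  rw [unifPr_eq_mean]; exact mean_nonneg fun _ => ind_nonneg _

lemma unifPr_le_one (p : Cube n → Prop) : unifPr p ≤ 1 := by
  rw [unifPr_eq_mean]; exact mean_le_of_le fun _ => ind_le_one _

lemma influence_nonneg (f : Cube n → Bool) (i : Fin n) : 0 ≤ influence f i := unifPr_nonneg _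

lemma influence_le_one (f : Cube n → Bool) (i : Fin n) : influence f i ≤ 1 := unifPr_le_one _

/-- Flipping the `i`-th bit is an involution of the cube. -/
def flip (i : Fin n) (x : Cube n) : Cube n := Function.update x i (!x i)

lemma flip_involutive (i : Fin n) : Function.Involutive (flip i) := by
  intro x
  simp [flip]

lemma sum_flip {M : Type*} [AddCommMonoid M] (i : Fin n) (g : Cube n → M) :
    ∑ x, g (flip i x) = ∑ x, g x :=
  Equiv.sum_comp (flip_involutive i).toPerm g

/-- Averaging over the `i`-th bit first. -/
lemma mean_split (i : Fin n) (F : Bool → Cube n → ℝ)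
    (hF : ∀ b x v, F b (Function.update x i v) = F b x) :
    mean (fun x => F (x i) x) = (mean (F true) + mean (F false)) / 2 := by
  have h1 : ∑ x, F (x i) x = ∑ x, F (!x i) x := by
    rw [← sum_flip i fun x => F (x i) x]
    refine Finset.sum_congr rfl fun x _ => ?_
    simp [flip, hF]
  have h2 : ∑ x, F (x i) x + ∑ x, F (!x i) x = ∑ x, F true x + ∑ x, F false x := by
    rw [← Finset.sum_add_distrib, ← Finset.sum_add_distrib]
    refine Finset.sum_congr rfl fun x _ => ?_
    cases x i <;> simp [add_comm]
  unfold mean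
  rw [← add_div, ← h2, ← h1]
  ring

/-! ### Partial assignments -/

/-- The point that agrees with `π` where it is defined and with `x` elsewhere. -/
def overlay (π : Fin n → Option Bool) (x : Cube n) : Cube n := fun i => (π i).getD (x i)

lemma overlay_of_some {π : Fin n → Option Bool} {i : Fin n} {b : Bool} (h : π i = some b)
    (x : Cube n) : overlay π x i = b := by simp [overlay, h]

lemma overlay_of_none {π : Fin n → Option Bool} {i : Fin n} (h : π i = none)
    (x : Cube n) : overlay π x i = x i := by simp [overlay, h]

lemma influence_eq_mean (f : Cube n → Bool) (i : Fin n) :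
    influence f i = mean fun x => ind (f x ≠ f (flip i x)) := unifPr_eq_mean _

lemma influence_restrict_of_some (f : Cube n → Bool) {π : Fin n → Option Bool} {i : Fin n}
    {b : Bool} (h : π i = some b) : influence (restrict f π) i = 0 := by
  rw [influence_eq_mean, ← mean_const (n := n) 0]
  refine mean_congr fun x => ind_of_false ?_
  simp only [ne_eq, not_not, restrict]
  congr 1
  funext j
  by_cases hj : j = i
  · subst hj; simp [h]
  · simp [flip, hj]

lemma overlay_flip {π : Fin n → Option Bool} {i : Fin n} (h : π i = none) (x : Cube n) :
    overlay π (flip i x) = flip i (overlay π x) := by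
  funext j
  by_cases hj : j = i
  · subst hj; simp [overlay, h, flip]
  · simp [flip, overlay, hj]

/-- The right-hand side does not vanish when `i` is fixed by `π`, so its average over the leaves of
a leaf map is exactly `influence f i`. This is the supermartingale property of the influence. -/
lemma influence_restrict_le (f : Cube n → Bool) (π : Fin n → Option Bool) (i : Fin n) :
    influence (restrict f π) i ≤
      mean fun z => ind (f (overlay π z) ≠ f (flip i (overlay π z))) := by
  rcases h : π i with _ | b
  · rw [influence_eq_mean]
    refine mean_mono fun x => ind_mono fun hx => ?_
    rw [← overlay_flip h]; exact hx
  · rw [influence_restrict_of_some f h]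
    exact mean_nonneg fun _ => ind_nonneg _

/-! ### Resampling within the leaves of a partition -/

/-- A map sending each point to a subcube containing it, such that these subcubes partition the
cube. -/
structure IsLeafMap (P : Cube n → Fin n → Option Bool) : Prop where
  consistent : ∀ x, overlay (P x) x = x
  stable : ∀ x z, P (overlay (P x) z) = P x

/-- Exchange the coordinates of `x` and `z` outside the subcube of `x`. -/
def leafSwap (P : Cube n → Fin n → Option Bool) (p : Cube n × Cube n) : Cube n × Cube n :=
  (overlay (P p.1) p.2, fun i => if (P p.1 i).isSome then p.2 i else p.1 i)

/-- By stability the new first point lies in the same leaf as the old one, so a second swap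
exchanges the same coordinates back. -/
lemma leafSwap_involutive {P : Cube n → Fin n → Option Bool} (hP : IsLeafMap P) :
    Function.Involutive (leafSwap P) := by
  rintro ⟨x, z⟩
  have hx := hP.consistent x
  simp only [leafSwap, hP.stable]
  refine Prod.ext (funext fun i => ?_) (funext fun i => ?_)
  · have := congrFun hx i
    rcases h : P x i with _ | b <;> simp_all [overlay]
  · rcases h : P x i with _ | b <;> simp_all [overlay]

/-- Resampling the point within its subcube preserves the uniform distribution. -/
lemma mean_mean_overlay {P : Cube n → Fin n → Option Bool} (hP : IsLeafMap P)
    (G : (Fin n → Option Bool) → Cube n → ℝ) :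
    mean (fun x => mean fun z => G (P x) (overlay (P x) z)) = mean fun x => G (P x) x := by
  -- Reindexing the pairs by the swap turns the resampled point into the first coordinate, and the
  -- second one is then averaged trivially.
  have h := Equiv.sum_comp (leafSwap_involutive hP).toPerm fun p => G (P p.1) p.1
  simp only [Function.Involutive.coe_toPerm, leafSwap, hP.stable] at h
  rw [Fintype.sum_prod_type, Fintype.sum_prod_type] at h
  unfold mean
  rw [← Finset.sum_div, h]
  simp [← Finset.mul_sum]

end Mean

/-! ### Decision trees and influences -/

section Trees

variable {n : ℕ}

lemma DecisionTree.queried_congr (T : DecisionTree n) {x y : Cube n}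
    (h : ∀ i ∈ T.queried x, y i = x i) : T.queried y = T.queried x ∧ T.eval y = T.eval x := by
  induction T with
  | leaf b => simp [queried, eval]
  | query i next ih =>
    have hi : y i = x i := h i (by simp [queried])
    have := ih (x i) fun j hj => h j (by simp [queried, hj])
    simp only [queried, eval, hi]
    exact ⟨by rw [this.1], this.2⟩

open Classical in
/-- The part of `x` learned by running `T` on the subcube `π`. -/
noncomputable def DecisionTree.learned (T : DecisionTree n) (π : Fin n → Option Bool)
    (x : Cube n) : Fin n → Option Bool :=
  fun i => if i ∈ T.queried (overlay π x) ∧ π i = none then some (x i) else none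

/-- Only coordinates that are not queried, or that `π` overrides anyway, are rerandomized, so the
tree follows the same path. -/
lemma DecisionTree.overlay_learned (T : DecisionTree n) (π : Fin n → Option Bool) (x z : Cube n) :
    T.queried (overlay π (overlay (T.learned π x) z)) = T.queried (overlay π x) ∧
      T.eval (overlay π (overlay (T.learned π x) z)) = T.eval (overlay π x) := by
  refine T.queried_congr fun i hi => ?_
  rcases h : π i with _ | b
  · simp [overlay, h, learned, hi]
  · simp [overlay, h]

lemma DecisionTree.isLeafMap_learned (T : DecisionTree n) (π : Fin n → Option Bool) :
    IsLeafMap (T.learned π) where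
  consistent x := by
    funext i
    by_cases h : i ∈ T.queried (overlay π x) ∧ π i = none <;> simp [overlay, learned, h]
  stable x z := by
    funext i
    have h := (T.overlay_learned π x z).1
    unfold learned at h ⊢
    rw [h]
    by_cases h' : i ∈ T.queried (overlay π x) ∧ π i = none <;> simp [h', overlay]

lemma overlay_update_none {π : Fin n → Option Bool} {i : Fin n} (h : π i = none) (x : Cube n) :
    overlay (Function.update π i (some (x i))) x = overlay π x := by
  funext j
  by_cases hj : j = i
  · subst hj; simp [overlay, h]
  · simp [overlay, hj]

lemma overlay_update_update (π : Fin n → Option Bool) (i : Fin n) (b v : Bool) (x : Cube n) :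
    overlay (Function.update π i (some b)) (Function.update x i v) =
      overlay (Function.update π i (some b)) x := by
  funext j
  by_cases hj : j = i
  · subst hj; simp [overlay]
  · simp [overlay, hj]

lemma DecisionTree.learned_update_update (T : DecisionTree n) (π : Fin n → Option Bool) (i : Fin n)
    (b v : Bool) (x : Cube n) :
    T.learned (Function.update π i (some b)) (Function.update x i v) =
      T.learned (Function.update π i (some b)) x := by
  funext j
  unfold learned
  rw [overlay_update_update]
  by_cases hj : j = i
  · subst hj; simp
  · simp [hj]

/-- In the child, coordinate `i` counts as fixed by the subcube, so its hybrid point still carries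
the fresh bit `z i`. Restoring `x i` there is the single change for which the hybrid argument pays
one influence. -/
lemma DecisionTree.overlay_learned_query {π : Fin n → Option Bool} {i : Fin n}
    (next : Bool → DecisionTree n) (h : π i = none) (x z : Cube n) :
    overlay ((query i next).learned π x) z =
      Function.update (overlay ((next (x i)).learned (Function.update π i (some (x i))) x) z)
        i (x i) := by
  funext j
  by_cases hj : j = i
  · subst hj; simp [overlay, learned, h, queried]
  · have hq : j ∈ (query i next).queried (overlay π x) ↔ j ∈ (next (x i)).queried
        (overlay (Function.update π i (some (x i))) x) := by
      rw [overlay_update_none h]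
      simp [queried, hj, overlay_of_none h]
    rw [Function.update_of_ne hj]
    simp only [overlay, learned, hq, Function.update_of_ne hj]

lemma update_bool_eq (x : Cube n) (i : Fin n) (b : Bool) :
    Function.update x i b = x ∨ Function.update x i b = flip i x := by
  by_cases h : b = x i
  · left; subst h; simp
  · right; unfold flip; congr 1; revert h; cases b <;> cases x i <;> simp

/-- A hybrid argument, along the lines of the inequality of O'Donnell, Saks, Schramm and Servedio:
rerandomizing what the tree does not query changes `g` at most with the probability given by the
influences of the queried variables. -/
theorem DecisionTree.mean_ne_le (g : Cube n → Bool) (T : DecisionTree n) :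
    ∀ π : Fin n → Option Bool,
    mean (fun x => mean fun z => ind (g (overlay (T.learned π x) z) ≠ g z)) ≤
      ∑ i, mean (fun x => ind (i ∈ T.queried (overlay π x) ∧ π i = none)) * influence g i := by
  induction T with
  | leaf b =>
    intro π
    have : mean (fun x => mean fun z =>
        ind (g (overlay ((DecisionTree.leaf b).learned π x) z) ≠ g z)) = 0 := by
      rw [← mean_const (n := n) 0]
      refine mean_congr fun x => ?_
      rw [← mean_const (n := n) 0]
      refine mean_congr fun z => ind_of_false ?_
      have : overlay ((DecisionTree.leaf b).learned π x) z = z := by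
        funext j; simp [learned, queried, overlay]
      simp [this]
    rw [this]
    exact Finset.sum_nonneg fun i _ =>
      mul_nonneg (mean_nonneg fun _ => ind_nonneg _) (influence_nonneg g i)
  | query i next ih =>
    intro π
    rcases h : π i with _ | b
    · set R : Bool → Cube n → Fin n → Option Bool := fun b =>
        (next b).learned (Function.update π i (some b)) with hR
      have hpt : ∀ x z, ind (g (overlay ((query i next).learned π x) z) ≠ g z) ≤
          ind (g (overlay (R (x i) x) z) ≠ g (flip i (overlay (R (x i) x) z))) +
            ind (g (overlay (R (x i) x) z) ≠ g z) := by
        intro x z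
        rw [overlay_learned_query next h]
        refine ind_le_add fun hne => ?_
        rcases update_bool_eq (overlay (R (x i) x) z) i (x i) with hu | hu
        · right; rw [← hu]; exact hne
        · by_cases hg : g (overlay (R (x i) x) z) = g (flip i (overlay (R (x i) x) z))
          · right; rw [hg]; rw [← hu]; exact hne
          · left; exact hg
      -- The child depends on the bit `x i`, but for fixed `b` the map `R b` ignores it, so this bit
      -- can be averaged out first.
      have hsplit := mean_split i
        (fun b x => mean fun z => ind (g (overlay (R b x) z) ≠ g (flip i (overlay (R b x) z))) +
            ind (g (overlay (R b x) z) ≠ g z))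
        (fun b x v => by simp only [hR, learned_update_update])
      have hone : ∀ b, mean (fun x => mean fun z =>
          ind (g (overlay (R b x) z) ≠ g (flip i (overlay (R b x) z))) +
            ind (g (overlay (R b x) z) ≠ g z)) ≤ influence g i +
          ∑ j, mean (fun x => ind (j ∈ (next b).queried
            (overlay (Function.update π i (some b)) x) ∧ Function.update π i (some b) j = none)) *
              influence g j := by
        intro b
        simp_rw [mean_add]
        -- `R b` is a leaf map, so the hybrid point is uniform and the cost of changing bit `i` is
        -- exactly its influence.
        refine add_le_add (le_of_eq ?_) (ih b _)
        rw [mean_mean_overlay (isLeafMap_learned _ _) fun _ y => ind (g y ≠ g (flip i y)),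
          influence_eq_mean]
      -- For `j = i` the children contribute nothing, as `i` is now fixed, and the root contributes
      -- probability 1.
      have hprob : ∀ j, (∑ b : Bool, mean (fun x => ind (j ∈ (next b).queried
            (overlay (Function.update π i (some b)) x) ∧
              Function.update π i (some b) j = none))) / 2 + (if j = i then 1 else 0) ≤
          mean (fun x => ind (j ∈ (query i next).queried (overlay π x) ∧ π j = none)) := by
        intro j
        by_cases hj : j = i
        · subst hj
          simp [h, queried, ind_of_false, ind_of_true, mean_const]
        · rw [Fintype.sum_bool, ← mean_split i (fun b x => ind (j ∈ (next b).queried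
            (overlay (Function.update π i (some b)) x) ∧
              Function.update π i (some b) j = none))
              (fun b x v => by simp only [overlay_update_update])]
          simp only [hj, if_false, add_zero]
          refine mean_mono fun x => ind_mono ?_
          rw [overlay_update_none h, Function.update_of_ne hj]
          rintro ⟨h1, h2⟩
          refine ⟨?_, h2⟩
          simp [queried, overlay_of_none h, h1]
      calc _ ≤ mean (fun x => mean fun z =>
              ind (g (overlay (R (x i) x) z) ≠ g (flip i (overlay (R (x i) x) z))) +
                ind (g (overlay (R (x i) x) z) ≠ g z)) :=
            mean_mono fun x => mean_mono fun z => hpt x z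
        _ ≤ influence g i + ∑ j, (∑ b : Bool, mean (fun x => ind (j ∈ (next b).queried
            (overlay (Function.update π i (some b)) x) ∧
              Function.update π i (some b) j = none))) / 2 * influence g j := by
            rw [hsplit]
            have h1 := hone true
            have h2 := hone false
            have h3 : ∑ j, (∑ b : Bool, mean (fun x => ind (j ∈ (next b).queried
              (overlay (Function.update π i (some b)) x) ∧
                Function.update π i (some b) j = none))) / 2 * influence g j =
              ((∑ j, mean (fun x => ind (j ∈ (next true).queried
                (overlay (Function.update π i (some true)) x) ∧
                  Function.update π i (some true) j = none)) * influence g j) +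
              (∑ j, mean (fun x => ind (j ∈ (next false).queried
                (overlay (Function.update π i (some false)) x) ∧
                  Function.update π i (some false) j = none)) * influence g j)) / 2 := by
              rw [← Finset.sum_add_distrib, Finset.sum_div]
              refine Finset.sum_congr rfl fun j _ => ?_
              rw [Fintype.sum_bool]; ring
            rw [h3]; linarith
        _ = ∑ j, ((∑ b : Bool, mean (fun x => ind (j ∈ (next b).queried
            (overlay (Function.update π i (some b)) x) ∧
              Function.update π i (some b) j = none))) / 2 + (if j = i then 1 else 0)) *
              influence g j := by
            simp_rw [add_mul, Finset.sum_add_distrib]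
            simp [add_comm]
        _ ≤ _ := Finset.sum_le_sum fun j _ =>
            mul_le_mul_of_nonneg_right (hprob j) (influence_nonneg g j)
    -- If `i` is already fixed, the root query reveals nothing new and the tree just follows the
    -- branch `b`.
    · have hl : ∀ x, (query i next).learned π x = (next b).learned π x := by
        intro x; funext j
        simp only [learned, queried, overlay_of_some h]
        by_cases hj : j = i
        · subst hj; simp [h]
        · simp [hj]
      simp_rw [hl]
      refine (ih b π).trans (Finset.sum_le_sum fun j _ => ?_)
      refine mul_le_mul_of_nonneg_right (mean_mono fun x => ind_mono ?_) (influence_nonneg g j)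
      rintro ⟨h1, h2⟩
      exact ⟨by simp [queried, overlay_of_some h, h1], h2⟩

/-- The distance of `g` to a constant, in terms of a tree for `g` on a subcube. -/
theorem exists_const_unifPr_ne_le (g : Cube n → Bool) (T : DecisionTree n)
    (π : Fin n → Option Bool) :
    ∃ b, unifPr (fun y => g y ≠ b) ≤ mean (fun x => ind (T.eval (overlay π x) ≠ g x)) +
      ∑ i, mean (fun x => ind (i ∈ T.queried (overlay π x) ∧ π i = none)) * influence g i := by
  by_contra! hcon
  -- If both constants were too far from `g`, so would be the random constant that `T` returns on an
  -- independent point `x`.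
  have h1 : mean (fun x => ind (T.eval (overlay π x) ≠ g x)) +
      ∑ i, mean (fun x => ind (i ∈ T.queried (overlay π x) ∧ π i = none)) * influence g i <
        mean (fun x => unifPr fun z => g z ≠ T.eval (overlay π x)) := by
    have hmin : ∀ a : ℝ, (∀ b, a < unifPr (fun y => g y ≠ b)) →
        a < mean (fun x => unifPr fun z => g z ≠ T.eval (overlay π x)) := by
      intro a ha
      have : a < min (unifPr (fun y => g y ≠ true)) (unifPr (fun y => g y ≠ false)) :=
        lt_min (ha _) (ha _)
      refine this.trans_le ?_
      rw [← mean_const (n := n) (min _ _)]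
      refine mean_mono fun x => ?_
      cases T.eval (overlay π x)
      · exact min_le_right _ _
      · exact min_le_left _ _
    exact hmin _ hcon
  -- Triangle inequality through the hybrid point, which agrees with `x` where the tree looked and
  -- with `z` elsewhere.
  have h2 : mean (fun x => unifPr fun z => g z ≠ T.eval (overlay π x)) ≤
      mean (fun x => mean fun z => ind (T.eval (overlay π x) ≠ g (overlay (T.learned π x) z))) +
        mean (fun x => mean fun z => ind (g (overlay (T.learned π x) z) ≠ g z)) := by
    rw [← mean_add]
    refine mean_mono fun x => ?_
    rw [← mean_add, unifPr_eq_mean]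
    refine mean_mono fun z => ind_le_add fun hne => ?_
    by_contra! hc
    exact hne (hc.2.symm.trans hc.1.symm)
  have h3 : mean (fun x => mean fun z =>
      ind (T.eval (overlay π x) ≠ g (overlay (T.learned π x) z))) =
      mean (fun x => ind (T.eval (overlay π x) ≠ g x)) := by
    rw [← mean_mean_overlay (T.isLeafMap_learned π)
      fun _ y => ind (T.eval (overlay π y) ≠ g y)]
    simp_rw [(T.overlay_learned π _ _).2]
  have h4 := T.mean_ne_le g π
  linarith

end Trees

/-! ### Online algorithms as decision trees -/

section OnlineTree

variable {n : ℕ}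

namespace OnlineAlg

lemma advance_of_output {A : OnlineAlg n} {β : ℝ} {c : Fin n → ℝ} {x : Cube n}
    {p : A.State × (Fin n → ℕ)} {b : Bool} (h : A.step p.1 = .output b) :
    A.advance β c x p = p := by
  unfold advance; rw [h]

lemma advance_of_think {A : OnlineAlg n} {β : ℝ} {c : Fin n → ℝ} {x : Cube n}
    {p : A.State × (Fin n → ℕ)} {s : A.State} (h : A.step p.1 = .think s) :
    A.advance β c x p = (s, p.2) := by
  unfold advance; rw [h]

lemma advance_of_invest {A : OnlineAlg n} {β : ℝ} {c : Fin n → ℝ} {x : Cube n}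
    {p : A.State × (Fin n → ℕ)} {i : Fin n} {next : Option Bool → A.State}
    (h : A.step p.1 = .invest i next) :
    A.advance β c x p =
      (next (if c i ≤ β * (p.2 i + 1 : ℕ) then some (x i) else none),
        Function.update p.2 i (p.2 i + 1)) := by
  unfold advance; rw [h]
  simp

lemma iterate_advance_of_output {A : OnlineAlg n} {β : ℝ} {c : Fin n → ℝ} {x : Cube n}
    {p : A.State × (Fin n → ℕ)} {b : Bool} (h : A.step p.1 = .output b) (t : ℕ) :
    (A.advance β c x)^[t] p = p :=
  Function.iterate_fixed (advance_of_output h) t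

lemma le_advance (A : OnlineAlg n) (β : ℝ) (c : Fin n → ℝ) (x : Cube n)
    (p : A.State × (Fin n → ℕ)) : p.2 ≤ (A.advance β c x p).2 := by
  rcases h : A.step p.1 with b | ⟨i, next⟩ | s
  · rw [advance_of_output h]
  · rw [advance_of_invest h]
    intro j
    by_cases hj : j = i
    · subst hj; simp
    · simp [hj]
  · rw [advance_of_think h]

lemma le_iterate_advance (A : OnlineAlg n) (β : ℝ) (c : Fin n → ℝ) (x : Cube n) (t : ℕ)
    (p : A.State × (Fin n → ℕ)) : p.2 ≤ ((A.advance β c x)^[t] p).2 := by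
  induction t generalizing p with
  | zero => exact le_rfl
  | succ t ih =>
    rw [Function.iterate_succ_apply]
    exact (A.le_advance β c x p).trans (ih _)

/-- The decision tree that simulates `t` steps of an online algorithm, for known costs. -/
noncomputable def toTree (A : OnlineAlg n) (β : ℝ) (c : Fin n → ℝ) :
    ℕ → A.State × (Fin n → ℕ) → DecisionTree n
  | 0, p =>
    match A.step p.1 with
    | .output b => .leaf b
    -- An arbitrary bit: only runs that have halted by then are compared with the tree.
    | _ => .leaf false
  | t + 1, p =>
    match A.step p.1 with
    | .output b => .leaf b
    | .think s => toTree A β c t (s, p.2)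
    | .invest i next =>
      if c i ≤ β * (p.2 i + 1 : ℕ) then
        .query i fun b => toTree A β c t (next (some b), Function.update p.2 i (p.2 i + 1))
      else toTree A β c t (next none, Function.update p.2 i (p.2 i + 1))

/-- The tree queries a variable only when the investment has reached its cost, and investments never
decrease. Hence the tree pays at most what the online algorithm has invested. -/
lemma toTree_spec (A : OnlineAlg n) {β : ℝ} (hβ : 0 < β) (c : Fin n → ℝ) (x : Cube n) (t : ℕ)
    (p : A.State × (Fin n → ℕ)) :
    (∀ i ∈ (A.toTree β c t p).queried x, c i ≤ β * ((A.advance β c x)^[t] p).2 i) ∧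
      ∀ b, A.step ((A.advance β c x)^[t] p).1 = .output b → (A.toTree β c t p).eval x = b := by
  induction t generalizing p with
  | zero =>
    rcases h : A.step p.1 with b | ⟨i, next⟩ | s <;>
      simp [toTree, h, DecisionTree.queried, DecisionTree.eval]
  | succ t ih =>
    rcases h : A.step p.1 with b | ⟨i, next⟩ | s
    · rw [iterate_advance_of_output h]
      simp [toTree, h, DecisionTree.queried, DecisionTree.eval]
    · rw [Function.iterate_succ_apply, advance_of_invest h]
      by_cases hc : c i ≤ β * (p.2 i + 1 : ℕ)
      · have := ih (next (some (x i)), Function.update p.2 i (p.2 i + 1))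
        simp only [toTree, h, hc, if_true, DecisionTree.queried, DecisionTree.eval]
        refine ⟨fun j hj => ?_, this.2⟩
        rcases Finset.mem_insert.1 hj with rfl | hj
        · refine hc.trans ?_
          have h2 := A.le_iterate_advance β c x t
            (next (some (x j)), Function.update p.2 j (p.2 j + 1)) j
          simp only [Function.update_self] at h2
          gcongr
        · exact this.1 j hj
      · have := ih (next none, Function.update p.2 i (p.2 i + 1))
        simp only [toTree, h, hc, if_false]
        exact this
    · rw [Function.iterate_succ_apply, advance_of_think h]
      simp only [toTree, h]
      exact ih _

lemma run_succ (A : OnlineAlg n) (β : ℝ) (c : Fin n → ℝ) (x : Cube n) (t : ℕ) :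
    A.run β c x (t + 1) = A.advance β c x (A.run β c x t) :=
  Function.iterate_succ_apply' _ _ _

lemma run_add (A : OnlineAlg n) (β : ℝ) (c : Fin n → ℝ) (x : Cube n) (t k : ℕ) :
    A.run β c x (t + k) = (A.advance β c x)^[k] (A.run β c x t) := by
  unfold run; rw [add_comm, Function.iterate_add_apply]

/-- A deterministic online algorithm is matched by a decision tree. -/
theorem exists_tree (A : OnlineAlg n) {β : ℝ} (hβ : 0 < β) (c : Fin n → ℝ) (f : Cube n → Bool) :
    ∃ T : DecisionTree n, T.error f ≤ A.error β c f ∧ T.avgCost c ≤ A.avgCost β c := by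
  classical
  have hex : ∀ x, ∃ t, A.Outputs β c x (f x) → A.step (A.run β c x t).1 = .output (f x) := by
    intro x
    by_cases h : A.Outputs β c x (f x)
    · exact ⟨h.choose, fun _ => h.choose_spec⟩
    · exact ⟨0, fun h' => absurd h' h⟩
  choose τ hτ using hex
  -- The cube is finite, so one depth covers all inputs on which the algorithm is correct. The other
  -- inputs are errors already, and there any output will do.
  set N := Finset.univ.sup τ
  refine ⟨A.toTree β c N (A.init, 0), ?_, ?_⟩
  · unfold DecisionTree.error error
    rw [unifPr_eq_mean, unifPr_eq_mean]
    refine mean_mono fun x => ind_mono fun hne hout => hne ?_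
    refine (A.toTree_spec hβ c x N (A.init, 0)).2 _ ?_
    have hle : τ x ≤ N := Finset.le_sup (f := τ) (Finset.mem_univ x)
    obtain ⟨k, hk⟩ := Nat.exists_eq_add_of_le hle
    have h1 := hτ x hout
    change A.step (A.run β c x N).1 = _
    rw [hk, run_add, iterate_advance_of_output h1, h1]
  · unfold DecisionTree.avgCost avgCost
    gcongr with x
    refine le_trans ?_ (le_iSup _ N)
    unfold DecisionTree.cost
    refine ENNReal.ofReal_le_ofReal ?_
    calc _ ≤ ∑ i ∈ (A.toTree β c N (A.init, 0)).queried x, β * ((A.run β c x N).2 i : ℝ) :=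
          Finset.sum_le_sum fun i hi => (A.toTree_spec hβ c x N (A.init, 0)).1 i hi
      _ ≤ _ := Finset.sum_le_sum_of_subset_of_nonneg (Finset.subset_univ _)
          fun i _ _ => by positivity

end OnlineAlg

/-! ### The benchmark -/

/-- The tree that queries the variables in a list and then evaluates `f`. -/
def queryAll (f : Cube n → Bool) : List (Fin n) → Cube n → DecisionTree n
  | [], x => .leaf (f x)
  | i :: l, x => .query i fun b => queryAll f l (Function.update x i b)

lemma eval_queryAll (f : Cube n → Bool) (l : List (Fin n)) (x y : Cube n) :
    (queryAll f l x).eval y = f fun i => if i ∈ l then y i else x i := by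
  induction l generalizing x with
  | nil => simp [queryAll, DecisionTree.eval]
  | cons i l ih =>
    simp only [queryAll, DecisionTree.eval, ih]
    congr 1
    funext j
    by_cases hj : j = i
    · subst hj; simp
    · simp [hj]

lemma exists_tree_eval_eq (f : Cube n → Bool) : ∃ T : DecisionTree n, ∀ y, T.eval y = f y :=
  ⟨queryAll f (List.finRange n) fun _ => false, fun y => by simp [eval_queryAll]⟩

lemma DecisionTree.avgCost_eq (T : DecisionTree n) {c : Fin n → ℝ} (hc : ∀ i, 0 ≤ c i) :
    T.avgCost c = ENNReal.ofReal (mean fun x => ∑ i ∈ T.queried x, c i) := by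
  unfold avgCost mean cost
  rw [ENNReal.ofReal_div_of_pos (by positivity), ENNReal.ofReal_sum_of_nonneg
    fun x _ => Finset.sum_nonneg fun i _ => hc i]
  congr 1
  rw [ENNReal.ofReal_pow (by norm_num)]
  simp

/-- Every online algorithm is dominated by a tree, in error and in cost. -/
lemma optAvg_eq (f : Cube n → Bool) (c : Fin n → ℝ) (ε : ℝ) :
    optAvg f c ε = (⨅ (T : DecisionTree n) (_ : T.error f ≤ ε), T.avgCost c).toReal := by
  unfold optAvg
  congr 1
  refine inf_eq_left.2 ?_
  refine le_iInf fun A => le_iInf fun β => le_iInf fun hβ => le_iInf fun h => ?_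
  obtain ⟨T, h1, h2⟩ := A.exists_tree hβ c f
  exact (iInf₂_le T (h1.trans h)).trans h2

lemma optAvg_le (f : Cube n → Bool) {c : Fin n → ℝ} (hc : ∀ i, 0 ≤ c i) {ε : ℝ}
    {T : DecisionTree n} (hT : T.error f ≤ ε) :
    optAvg f c ε ≤ mean fun x => ∑ i ∈ T.queried x, c i := by
  rw [optAvg_eq]
  refine ENNReal.toReal_le_of_le_ofReal (mean_nonneg fun x => Finset.sum_nonneg fun i _ => hc i) ?_
  rw [← T.avgCost_eq hc]
  exact iInf₂_le T hT

/-- Finiteness of the infimum has to be checked, since `toReal` sends `∞` to 0; the tree that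
evaluates `f` exactly provides it. -/
lemma exists_tree_near_optAvg (f : Cube n → Bool) {c : Fin n → ℝ} (hc : ∀ i, 0 ≤ c i) {ε η : ℝ}
    (hε : 0 ≤ ε) (hη : 0 < η) :
    ∃ T : DecisionTree n, T.error f ≤ ε ∧
      mean (fun x => ∑ i ∈ T.queried x, c i) < optAvg f c ε + η := by
  by_contra! hcon
  obtain ⟨T₀, hT₀⟩ := exists_tree_eval_eq f
  have hT₀' : T₀.error f ≤ ε := by
    refine le_trans (le_of_eq ?_) hε
    unfold DecisionTree.error
    rw [unifPr_eq_mean, ← mean_const (n := n) 0]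
    exact mean_congr fun x => ind_of_false (by simp [hT₀])
  have hfin : (⨅ (T : DecisionTree n) (_ : T.error f ≤ ε), T.avgCost c) ≠ ∞ := by
    refine ne_top_of_le_ne_top ?_ (iInf₂_le T₀ hT₀')
    rw [T₀.avgCost_eq hc]
    exact ENNReal.ofReal_ne_top
  have h : ENNReal.ofReal (optAvg f c ε + η) ≤
      ⨅ (T : DecisionTree n) (_ : T.error f ≤ ε), T.avgCost c := by
    refine le_iInf₂ fun T hT => ?_
    rw [T.avgCost_eq hc]
    exact ENNReal.ofReal_le_ofReal (hcon T hT)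
  have h2 := (ENNReal.ofReal_le_iff_le_toReal hfin).1 h
  rw [← optAvg_eq] at h2
  linarith

/-- If the benchmark is positive, then `f` is far from constant, so it has some influence. -/
lemma lt_totalInfluence_of_optAvg_pos (f : Cube n → Bool) {c : Fin n → ℝ} (hc : ∀ i, 0 ≤ c i)
    {ε : ℝ} (h : 0 < optAvg f c ε) : ε < totalInfluence f := by
  obtain ⟨T, hT⟩ := exists_tree_eval_eq f
  -- An exact tree on the whole cube gives a Poincaré-type inequality: some constant is within
  -- `totalInfluence f` of `f`. If that were at most `ε`, a leaf of cost 0 would be feasible.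
  obtain ⟨b, hb⟩ := exists_const_unifPr_ne_le f T fun _ => none
  have h1 : mean (fun x => ind (T.eval (overlay (fun _ => none) x) ≠ f x)) = 0 := by
    rw [← mean_const (n := n) 0]
    exact mean_congr fun x => ind_of_false (by rw [hT]; exact not_not.2 rfl)
  have h2 : ∑ i, mean (fun x => ind (i ∈ T.queried (overlay (fun _ => none) x) ∧
      (none : Option Bool) = none)) * influence f i ≤ totalInfluence f := by
    refine Finset.sum_le_sum fun i _ => ?_
    refine mul_le_of_le_one_left (influence_nonneg f i) (mean_le_of_le fun _ => ind_le_one _)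
  by_contra! hle
  have h3 : (DecisionTree.leaf b).error f ≤ ε := by
    unfold DecisionTree.error
    simp only [DecisionTree.eval]
    simp_rw [ne_comm (a := b)]
    linarith
  have h4 := optAvg_le f hc h3
  simp only [DecisionTree.queried, Finset.sum_empty, mean_const] at h4
  linarith

end OnlineTree

/-! ### Runs of IPRR -/

section IPRR

variable {n : ℕ}

/-- The state after an investment in `x_i` with response `r`. -/
def IPRRState.respond (s : IPRRState n) (i : Fin n) (r : Option Bool) : IPRRState n :=
  { units := Function.update s.units i (s.units i + 1)
    π := match r with
      | none => s.π
      | some b => Function.update s.π i (some b) }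

/-- All that the analysis needs from the greedy rule is the threshold; maximality serves only to
bound all ratios at halting, and tie-breaking is irrelevant. -/
lemma iprrStep_cases (f : Cube n → Bool) (ε B β : ℝ) (s : IPRRState n) :
    (iprrStep f ε B β s = .output (roundedMean f s.π) ∧
        ∀ i, iprrRatio f β s i < ENNReal.ofReal (ε / B)) ∨
      ∃ i, iprrStep f ε B β s = .invest i (s.respond i) ∧
        ENNReal.ofReal (ε / B) ≤ iprrRatio f β s i := by
  unfold iprrStep
  rcases h : (List.finRange n).argmax (iprrRatio f β s) with _ | i
  · left
    refine ⟨rfl, fun i => ?_⟩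
    rw [List.argmax_eq_none] at h
    exact absurd (List.mem_finRange i) (by simp [h])
  · by_cases hi : iprrRatio f β s i < ENNReal.ofReal (ε / B)
    · left
      refine ⟨by simp [hi], fun j => ?_⟩
      exact (List.le_of_mem_argmax (List.mem_finRange j) (by rw [h]; rfl)).trans_lt hi
    · right
      exact ⟨i, by simp only [hi, if_false]; rfl, not_lt.1 hi⟩

/-- The cost half of the threshold rule. It limits the investment before the next unit, which is why
one extra `β` appears in all cost bounds. -/
lemma units_le_of_ratio_ge {f : Cube n → Bool} {ε B β : ℝ} (hε : 0 < ε) (hB : 0 < B) (hβ : 0 < β)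
    {s : IPRRState n} {i : Fin n} (h : ENNReal.ofReal (ε / B) ≤ iprrRatio f β s i) :
    β * s.units i ≤ B / ε * influence (restrict f s.π) i := by
  have hI := influence_nonneg (restrict f s.π) i
  rcases Nat.eq_zero_or_pos (s.units i) with h0 | h0
  · rw [h0]; simp; positivity
  · have hpos : 0 < β * s.units i := by positivity
    unfold iprrRatio at h
    rw [← ENNReal.ofReal_div_of_pos hpos, ENNReal.ofReal_le_ofReal_iff (by positivity),
      div_le_div_iff₀ hB hpos] at h
    rw [div_mul_eq_mul_div, le_div_iff₀ hε]
    linarith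

/-- The error half of the threshold rule. With no investment, a ratio below a finite threshold
forces the influence to be 0, as it would be `∞` otherwise. -/
lemma influence_le_of_ratio_lt {f : Cube n → Bool} {ε B β : ℝ} (hε : 0 < ε) (hB : 0 < B)
    (hβ : 0 < β) {s : IPRRState n} {i : Fin n}
    (h : iprrRatio f β s i < ENNReal.ofReal (ε / B)) :
    influence (restrict f s.π) i ≤ ε / B * (β * s.units i) := by
  have hI := influence_nonneg (restrict f s.π) i
  rcases Nat.eq_zero_or_pos (s.units i) with h0 | h0
  · rw [h0]
    by_contra! hlt
    have hne : ENNReal.ofReal (influence (restrict f s.π) i) ≠ 0 := by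
      rw [ne_eq, ENNReal.ofReal_eq_zero, not_le]; simpa using hlt
    unfold iprrRatio at h
    rw [h0] at h
    simp [ENNReal.div_zero hne] at h
  · have hpos : 0 < β * s.units i := by positivity
    unfold iprrRatio at h
    rw [← ENNReal.ofReal_div_of_pos hpos] at h
    have h' := (ENNReal.ofReal_lt_ofReal_iff (by positivity)).1 h
    rw [div_lt_iff₀ hpos] at h'
    exact h'.le

/-- One step of IPRR on the input `y`. -/
noncomputable def iprrNext (f : Cube n → Bool) (ε B β : ℝ) (c : Fin n → ℝ) (y : Cube n)
    (s : IPRRState n) : IPRRState n :=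
  match iprrStep f ε B β s with
  | .output _ => s
  | .think t => t
  | .invest i next => next (if c i ≤ β * (s.units i + 1 : ℕ) then some (y i) else none)

/-- The state of IPRR on the input `y` after `t` steps. -/
noncomputable def iprrRun (f : Cube n → Bool) (ε B β : ℝ) (c : Fin n → ℝ) (y : Cube n) (t : ℕ) :
    IPRRState n :=
  (iprrNext f ε B β c y)^[t] (IPRRState.start n)

/-- IPRR halts in the state `s`. -/
def IPRRHalted (f : Cube n → Bool) (ε B β : ℝ) (s : IPRRState n) : Prop :=
  ∃ b, iprrStep f ε B β s = .output b

variable {f : Cube n → Bool} {ε B β : ℝ} {c : Fin n → ℝ} {y : Cube n}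

lemma iprrRun_succ (t : ℕ) :
    iprrRun f ε B β c y (t + 1) = iprrNext f ε B β c y (iprrRun f ε B β c y t) :=
  Function.iterate_succ_apply' _ _ _

lemma iprrNext_of_halted {s : IPRRState n} (h : IPRRHalted f ε B β s) :
    iprrNext f ε B β c y s = s := by
  obtain ⟨b, hb⟩ := h
  unfold iprrNext; rw [hb]

lemma iprrNext_of_invest {s : IPRRState n} {i : Fin n} {next : Option Bool → IPRRState n}
    (h : iprrStep f ε B β s = .invest i next) : iprrNext f ε B β c y s =
      next (if c i ≤ β * (s.units i + 1 : ℕ) then some (y i) else none) := by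
  unfold iprrNext; rw [h]

lemma iprrRun_of_halted {t : ℕ} (h : IPRRHalted f ε B β (iprrRun f ε B β c y t)) {t' : ℕ}
    (ht : t ≤ t') : iprrRun f ε B β c y t' = iprrRun f ε B β c y t := by
  induction t', ht using Nat.le_induction with
  | base => rfl
  | succ k _ ih => rw [iprrRun_succ, ih, iprrNext_of_halted h]

lemma exists_invest_of_not_halted {s : IPRRState n} (h : ¬ IPRRHalted f ε B β s) :
    ∃ i, iprrStep f ε B β s = .invest i (s.respond i) ∧
      ENNReal.ofReal (ε / B) ≤ iprrRatio f β s i := by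
  rcases iprrStep_cases f ε B β s with h1 | h1
  · exact absurd ⟨_, h1.1⟩ h
  · exact h1

/-- What is known about a state in a run of IPRR on `y`. -/
structure IPRRValid (ε B β : ℝ) (c : Fin n → ℝ) (y : Cube n) (s : IPRRState n) : Prop where
  eq_of_some : ∀ j b, s.π j = some b → b = y j
  -- The first alternative covers `c j = 0`: even a free variable is revealed only after an
  -- investment.
  lt_of_none : ∀ j, s.π j = none → s.units j = 0 ∨ β * s.units j < c j
  units_le : ∀ j, β * s.units j ≤ β + B / ε

lemma iprrValid_next (hε : 0 < ε) (hB : 0 < B) (hβ : 0 < β) {s : IPRRState n}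
    (hs : IPRRValid ε B β c y s) : IPRRValid ε B β c y (iprrNext f ε B β c y s) := by
  by_cases hh : IPRRHalted f ε B β s
  · rwa [iprrNext_of_halted hh]
  · obtain ⟨i, h1, h2⟩ := exists_invest_of_not_halted hh
    rw [iprrNext_of_invest h1]
    have h3 : β * s.units i ≤ B / ε := (units_le_of_ratio_ge hε hB hβ h2).trans
      (mul_le_of_le_one_right (by positivity) (influence_le_one _ i))
    have h4 : ∀ r j, β * (s.respond i r).units j ≤ β + B / ε := by
      intro r j
      by_cases hj : j = i
      · subst hj; simp [IPRRState.respond]; linarith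
      · simpa [IPRRState.respond, hj] using hs.units_le j
    by_cases hc : c i ≤ β * (s.units i + 1 : ℕ)
    · rw [if_pos hc]
      refine ⟨fun j b hb => ?_, fun j hj => ?_, h4 _⟩
      · by_cases hj : j = i
        · subst hj; simp [IPRRState.respond] at hb; exact hb.symm
        · simp [IPRRState.respond, hj] at hb; exact hs.eq_of_some j b hb
      · by_cases hji : j = i
        · subst hji; simp [IPRRState.respond] at hj
        · simp only [IPRRState.respond, ne_eq, hji, not_false_eq_true,
            Function.update_of_ne] at hj ⊢
          exact hs.lt_of_none j hj
    · rw [if_neg hc]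
      refine ⟨fun j b hb => hs.eq_of_some j b hb, fun j hj => ?_, h4 _⟩
      by_cases hji : j = i
      · subst hji; right; simpa [IPRRState.respond] using hc
      · simp only [IPRRState.respond, ne_eq, hji, not_false_eq_true, Function.update_of_ne]
        exact hs.lt_of_none j hj

lemma iprrValid_run (hε : 0 < ε) (hB : 0 < B) (hβ : 0 < β) (t : ℕ) :
    IPRRValid ε B β c y (iprrRun f ε B β c y t) := by
  induction t with
  | zero =>
    refine ⟨fun j b h => ?_, fun j _ => Or.inl rfl, fun j => ?_⟩
    · simp [iprrRun, IPRRState.start] at h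
    · simp [iprrRun, IPRRState.start]; positivity
  | succ t ih => rw [iprrRun_succ]; exact iprrValid_next hε hB hβ ih

lemma sum_units_next {s : IPRRState n} (h : ¬ IPRRHalted f ε B β s) :
    ∑ j, (iprrNext f ε B β c y s).units j = ∑ j, s.units j + 1 := by
  obtain ⟨i, h1, -⟩ := exists_invest_of_not_halted h
  rw [iprrNext_of_invest h1]
  simp only [IPRRState.respond]
  rw [Finset.sum_update_of_mem (Finset.mem_univ i),
    ← Finset.sum_sdiff (Finset.subset_univ {i}) (f := s.units)]
  simp; ring

/-- Every step that does not halt adds one unit, whereas the investment in each variable is bounded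
because influences are at most 1. -/
lemma exists_iprrHalted (f : Cube n → Bool) (c : Fin n → ℝ) (hε : 0 < ε) (hB : 0 < B)
    (hβ : 0 < β) (y : Cube n) : ∃ t, IPRRHalted f ε B β (iprrRun f ε B β c y t) := by
  by_contra! hcon
  have h1 : ∀ t, ∑ j, (iprrRun f ε B β c y t).units j = t := by
    intro t
    induction t with
    | zero => simp [iprrRun, IPRRState.start]
    | succ t ih => rw [iprrRun_succ, sum_units_next (hcon t), ih]
  have h2 : ∀ t : ℕ, β * t ≤ n * (β + B / ε) := by
    intro t
    rw [← h1 t]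
    push_cast
    rw [Finset.mul_sum]
    refine (Finset.sum_le_sum fun j _ => (iprrValid_run hε hB hβ t).units_le j).trans ?_
    simp [mul_add]
  obtain ⟨t, ht⟩ := exists_nat_gt (n * (β + B / ε) / β)
  rw [div_lt_iff₀ hβ] at ht
  linarith [h2 t]

lemma iprrRun_π_mono (hε : 0 < ε) (hB : 0 < B) (hβ : 0 < β) {t t' : ℕ} (ht : t ≤ t') {j : Fin n}
    {b : Bool} (h : (iprrRun f ε B β c y t).π j = some b) :
    (iprrRun f ε B β c y t').π j = some b := by
  induction t', ht using Nat.le_induction with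
  | base => exact h
  | succ k _ ih =>
    rw [iprrRun_succ]
    by_cases hh : IPRRHalted f ε B β (iprrRun f ε B β c y k)
    · rwa [iprrNext_of_halted hh]
    · obtain ⟨i, h1, -⟩ := exists_invest_of_not_halted hh
      rw [iprrNext_of_invest h1]
      split_ifs with hc
      · by_cases hj : j = i
        · subst hj
          have := (iprrValid_run hε hB hβ k).eq_of_some j b ih
          simp [IPRRState.respond, this]
        · simpa [IPRRState.respond, hj] using ih
      · exact ih

/-- A run depends only on the bits that are revealed in it. -/
lemma iprrRun_congr (hε : 0 < ε) (hB : 0 < B) (hβ : 0 < β) {z : Cube n} {T : ℕ}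
    (h : ∀ j b, (iprrRun f ε B β c y T).π j = some b → z j = b) {t : ℕ} (ht : t ≤ T) :
    iprrRun f ε B β c z t = iprrRun f ε B β c y t := by
  induction t with
  | zero => rfl
  | succ t ih =>
    rw [iprrRun_succ, ih (Nat.le_of_succ_le ht), iprrRun_succ]
    by_cases hh : IPRRHalted f ε B β (iprrRun f ε B β c y t)
    · rw [iprrNext_of_halted hh, iprrNext_of_halted hh]
    · obtain ⟨i, h1, -⟩ := exists_invest_of_not_halted hh
      rw [iprrNext_of_invest h1, iprrNext_of_invest h1]
      split_ifs with hc
      · have h3 : (iprrRun f ε B β c y (t + 1)).π i = some (y i) := by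
          rw [iprrRun_succ, iprrNext_of_invest h1, if_pos hc]
          simp [IPRRState.respond]
        rw [h i _ (iprrRun_π_mono hε hB hβ ht h3)]
      · rfl

open Classical in
/-- The restriction at the first time when the state satisfies `Q`. -/
noncomputable def stoppedπ (f : Cube n → Bool) (ε B β : ℝ) (c : Fin n → ℝ)
    (Q : IPRRState n → Prop) (hQ : ∀ y, ∃ t, Q (iprrRun f ε B β c y t)) (y : Cube n) :
    Fin n → Option Bool :=
  (iprrRun f ε B β c y (Nat.find (hQ y))).π

lemma stoppedπ_spec (Q : IPRRState n → Prop) (hQ : ∀ y, ∃ t, Q (iprrRun f ε B β c y t))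
    (y : Cube n) : ∃ T, stoppedπ f ε B β c Q hQ y = (iprrRun f ε B β c y T).π ∧
      Q (iprrRun f ε B β c y T) ∧ ∀ t, Q (iprrRun f ε B β c y t) → T ≤ t := by
  classical
  exact ⟨Nat.find (hQ y), by unfold stoppedπ; congr!, Nat.find_spec (hQ y),
    fun t ht => Nat.find_min' (hQ y) ht⟩

/-- An input that shares the bits revealed before the stopping time has the same run up to then, so
it stops at the same time with the same restriction. -/
lemma isLeafMap_stoppedπ (hε : 0 < ε) (hB : 0 < B) (hβ : 0 < β) (Q : IPRRState n → Prop)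
    (hQ : ∀ y, ∃ t, Q (iprrRun f ε B β c y t)) : IsLeafMap (stoppedπ f ε B β c Q hQ) where
  consistent y := by
    classical
    funext j
    rcases h : stoppedπ f ε B β c Q hQ y j with _ | b
    · exact overlay_of_none h y
    · rw [overlay_of_some h]
      exact (iprrValid_run hε hB hβ _).eq_of_some j b h
  stable y z := by
    classical
    set w := overlay (stoppedπ f ε B β c Q hQ y) z
    have hrun : ∀ t ≤ Nat.find (hQ y), iprrRun f ε B β c w t = iprrRun f ε B β c y t :=
      fun t ht => iprrRun_congr hε hB hβ (fun j b hb => overlay_of_some hb z) ht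
    have hfind : Nat.find (hQ w) = Nat.find (hQ y) := by
      rw [Nat.find_eq_iff]
      refine ⟨?_, fun t ht => ?_⟩
      · rw [hrun _ le_rfl]; exact Nat.find_spec (hQ y)
      · rw [hrun t ht.le]; exact Nat.find_min (hQ y) ht
    unfold stoppedπ
    rw [hfind, hrun _ le_rfl]

/-! ### The output of IPRR -/

open Classical in
/-- The output of IPRR on the input `y`. -/
noncomputable def iprrOut (f : Cube n → Bool) (ε B β : ℝ) (c : Fin n → ℝ) (y : Cube n) : Bool :=
  if h : ∃ b t, iprrStep f ε B β (iprrRun f ε B β c y t) = .output b then h.choose else false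

lemma iprrOut_eq {t : ℕ} {b : Bool} (h : iprrStep f ε B β (iprrRun f ε B β c y t) = .output b) :
    iprrOut f ε B β c y = b := by
  have hex : ∃ b t, iprrStep f ε B β (iprrRun f ε B β c y t) = .output b := ⟨b, t, h⟩
  unfold iprrOut
  rw [dif_pos hex]
  obtain ⟨t', ht'⟩ := hex.choose_spec
  have key : iprrRun f ε B β c y t = iprrRun f ε B β c y t' := by
    rcases le_total t t' with hle | hle
    · exact (iprrRun_of_halted ⟨_, h⟩ hle).symm
    · exact iprrRun_of_halted ⟨_, ht'⟩ hle
  rw [key, ht'] at h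
  exact Action.output.inj h

/-- The rounded mean is the majority value, so it does at least as well as the unknown constant
given by `exists_const_unifPr_ne_le`. -/
lemma unifPr_ne_roundedMean_le (f : Cube n → Bool) (π : Fin n → Option Bool) (b : Bool) :
    unifPr (fun z => restrict f π z ≠ roundedMean f π) ≤ unifPr fun z => restrict f π z ≠ b := by
  have h1 : unifPr (fun z => restrict f π z ≠ false) = unifPr fun z => restrict f π z = true := by
    simp
  have h2 : unifPr (fun z => restrict f π z ≠ true) +
      unifPr (fun z => restrict f π z = true) = 1 := by
    rw [unifPr_eq_mean, unifPr_eq_mean, ← mean_add, ← mean_const (n := n) 1]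
    refine mean_congr fun z => ?_
    by_cases h : restrict f π z = true
    · rw [ind_of_true h, ind_of_false (not_not.2 h)]; norm_num
    · rw [ind_of_false h, ind_of_true h]; norm_num
  by_cases hp : (1 : ℝ) / 2 ≤ unifPr fun z => restrict f π z = true
  · have : roundedMean f π = true := by simp only [roundedMean, hp, decide_true]
    rw [this]
    cases b
    · rw [h1]; linarith
    · exact le_rfl
  · have : roundedMean f π = false := by simp only [roundedMean, hp, decide_false]
    rw [this]
    cases b
    · exact le_rfl
    · rw [h1]; linarith

/-- The error of `IPRR(f, ε, B)`, in terms of any decision tree. -/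
lemma iprr_error_le_tree (hε : 0 < ε) (hB : 0 < B) (hβ : 0 < β) (hc : ∀ i, 0 ≤ c i)
    (T : DecisionTree n) :
    unifPr (fun y => iprrOut f ε B β c y ≠ f y) ≤
      T.error f + ε / B * mean fun x => ∑ i ∈ T.queried x, c i := by
  classical
  have hQ := exists_iprrHalted f c hε hB hβ (ε := ε) (B := B)
  set P := stoppedπ f ε B β c _ hQ with hPdef
  have hP : IsLeafMap P := isLeafMap_stoppedπ hε hB hβ _ hQ
  have hstep : ∀ y, ∃ s : IPRRState n, s.π = P y ∧ IPRRValid ε B β c y s ∧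
      iprrStep f ε B β s = .output (roundedMean f s.π) ∧ iprrOut f ε B β c y = roundedMean f s.π ∧
        ∀ i, iprrRatio f β s i < ENNReal.ofReal (ε / B) := by
    intro y
    have hh := Nat.find_spec (hQ y)
    refine ⟨iprrRun f ε B β c y (Nat.find (hQ y)), rfl, iprrValid_run hε hB hβ _, ?_⟩
    rcases iprrStep_cases f ε B β (iprrRun f ε B β c y (Nat.find (hQ y))) with h | ⟨i, h, -⟩
    · exact ⟨h.1, iprrOut_eq h.1, h.2⟩
    · obtain ⟨b, hb⟩ := hh
      rw [h] at hb; cases hb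
  have hleaf : ∀ y, unifPr (fun z => restrict f (P y) z ≠ roundedMean f (P y)) ≤
      mean (fun x => ind (T.eval (overlay (P y) x) ≠ f (overlay (P y) x)) +
        ε / B * ∑ i ∈ T.queried (overlay (P y) x), c i) := by
    intro y
    obtain ⟨s, hs1, hs2, -, -, hs4⟩ := hstep y
    obtain ⟨b, hb⟩ := exists_const_unifPr_ne_le (restrict f (P y)) T (P y)
    refine (unifPr_ne_roundedMean_le f (P y) b).trans (hb.trans ?_)
    rw [mean_add]
    refine add_le_add le_rfl ?_
    simp_rw [← mean_mul_const]
    rw [← mean_sum]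
    refine mean_mono fun x => ?_
    rw [Finset.mul_sum, ← Finset.sum_filter_add_sum_filter_not Finset.univ
      (· ∈ T.queried (overlay (P y) x)),
      Finset.sum_eq_zero (s := Finset.univ.filter (· ∉ T.queried (overlay (P y) x))), add_zero,
      Finset.filter_univ_mem]
    · refine Finset.sum_le_sum fun i hi => ?_
      rcases h : P y i with _ | b
      -- An unrevealed variable has investment at most its cost, so the halting rule charges its
      -- influence to `c i`. Revealed variables do not count in the sum.
      · have h1 : influence (restrict f (P y)) i ≤ ε / B * c i := by
          have h2 := influence_le_of_ratio_lt hε hB hβ (hs4 i)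
          rw [hs1] at h2
          refine h2.trans (mul_le_mul_of_nonneg_left ?_ (by positivity))
          rcases hs2.lt_of_none i (by rw [hs1, h]) with h3 | h3
          · rw [h3]; simpa using hc i
          · exact h3.le
        exact (mul_le_of_le_one_left (influence_nonneg _ _) (ind_le_one _)).trans h1
      · rw [ind_of_false (by simp), zero_mul]
        have := hc i
        positivity
    · intro i hi
      rw [ind_of_false (fun h => (Finset.mem_filter.1 hi).2 h.1), zero_mul]
  -- The output is constant on each leaf, so the error is the average over leaves of the error
  -- inside the leaf.
  have h1 : unifPr (fun y => iprrOut f ε B β c y ≠ f y) =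
      mean fun y => unifPr fun z => restrict f (P y) z ≠ roundedMean f (P y) := by
    simp_rw [unifPr_eq_mean]
    have := mean_mean_overlay hP fun π y => ind (f y ≠ roundedMean f π)
    refine Eq.trans ?_ this.symm
    refine mean_congr fun y => ind_congr ?_
    obtain ⟨s, hs1, -, -, hs3, -⟩ := hstep y
    rw [hs3, hs1, ne_comm]
  rw [h1]
  refine (mean_mono hleaf).trans (le_of_eq ?_)
  rw [mean_mean_overlay hP fun _ x => ind (T.eval x ≠ f x) + ε / B * ∑ i ∈ T.queried x, c i,
    mean_add, mean_const_mul]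
  unfold DecisionTree.error
  rw [unifPr_eq_mean]

/-- The error of `IPRR(f, ε, B)` in terms of the benchmark. -/
theorem iprr_error_le (hε : 0 < ε) (hB : 0 < B) (hβ : 0 < β) (hc : ∀ i, 0 ≤ c i) :
    unifPr (fun y => iprrOut f ε B β c y ≠ f y) ≤ ε + ε / B * optAvg f c ε := by
  refine le_of_forall_pos_le_add fun δ hδ => ?_
  obtain ⟨T, hT1, hT2⟩ := exists_tree_near_optAvg f hc hε.le
    (η := δ / (ε / B)) (by positivity)
  refine (iprr_error_le_tree hε hB hβ hc T).trans ?_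
  have : ε / B * mean (fun x => ∑ i ∈ T.queried x, c i) ≤
      ε / B * (optAvg f c ε + δ / (ε / B)) :=
    mul_le_mul_of_nonneg_left hT2.le (by positivity)
  rw [mul_add, mul_div_cancel₀ _ (by positivity)] at this
  linarith

/-! ### The maximal influence in a run of IPRR -/

/-- The largest influence of the `j`-th variable in a run of IPRR. -/
noncomputable def maxInf (f : Cube n → Bool) (ε B β : ℝ) (c : Fin n → ℝ) (j : Fin n)
    (y : Cube n) : ℝ :=
  ⨆ t, influence (restrict f (iprrRun f ε B β c y t).π) j

lemma bddAbove_influence_run (f : Cube n → Bool) (ε B β : ℝ) (c : Fin n → ℝ) (j : Fin n)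
    (y : Cube n) :
    BddAbove (Set.range fun t => influence (restrict f (iprrRun f ε B β c y t).π) j) :=
  ⟨1, by rintro _ ⟨t, rfl⟩; exact influence_le_one _ j⟩

lemma influence_le_maxInf (f : Cube n → Bool) (ε B β : ℝ) (c : Fin n → ℝ) (j : Fin n)
    (y : Cube n) (t : ℕ) :
    influence (restrict f (iprrRun f ε B β c y t).π) j ≤ maxInf f ε B β c j y :=
  le_ciSup (bddAbove_influence_run f ε B β c j y) t

lemma maxInf_nonneg (j : Fin n) : 0 ≤ maxInf f ε B β c j y :=
  (influence_nonneg _ j).trans (influence_le_maxInf f ε B β c j y 0)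

lemma maxInf_le_one (j : Fin n) : maxInf f ε B β c j y ≤ 1 :=
  ciSup_le fun _ => influence_le_one _ j

/-- Doob's maximal inequality for the influence of the `j`-th variable. -/
lemma mul_unifPr_lt_maxInf_le (f : Cube n → Bool) (c : Fin n → ℝ) (hε : 0 < ε) (hB : 0 < B)
    (hβ : 0 < β) (j : Fin n) (l : ℝ) :
    l * unifPr (fun y => l < maxInf f ε B β c j y) ≤ influence f j := by
  classical
  -- Stopping at the first crossing of `l`, or at halting, makes this optional stopping for the
  -- influence.
  set Q : IPRRState n → Prop := fun s => l < influence (restrict f s.π) j ∨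
    IPRRHalted f ε B β s
  have hQ : ∀ y, ∃ t, Q (iprrRun f ε B β c y t) := fun y => by
    obtain ⟨t, ht⟩ := exists_iprrHalted f c hε hB hβ y
    exact ⟨t, Or.inr ht⟩
  have hP := isLeafMap_stoppedπ hε hB hβ Q hQ
  rw [unifPr_eq_mean, ← mean_const_mul, influence_eq_mean,
    ← mean_mean_overlay hP fun _ x => ind (f x ≠ f (flip j x))]
  refine mean_mono fun y => ?_
  refine le_trans ?_ (influence_restrict_le f _ j)
  by_cases hy : l < maxInf f ε B β c j y
  · rw [ind_of_true hy, mul_one]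
    obtain ⟨t, ht⟩ := exists_lt_of_lt_ciSup hy
    obtain ⟨T, hT1, hT2, hT3⟩ := stoppedπ_spec Q hQ y
    rw [hT1]
    rcases hT2 with h | h
    · exact h.le
    -- If the run halted first, its state no longer changes, so the crossing at time `t` is already
    -- visible at the stopping time.
    · rw [iprrRun_of_halted h (hT3 t (Or.inl ht))] at ht
      exact ht.le
  · rw [ind_of_false hy, mul_zero]; exact influence_nonneg _ j

lemma intervalIntegrable_ind_lt (M a b : ℝ) :
    IntervalIntegrable (fun l : ℝ => ind (l < M)) MeasureTheory.volume a b :=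
  Antitone.intervalIntegrable fun _ _ h => ind_mono fun h' => h.trans_lt h'

/-- Layer-cake formula: the integral is the length of the part of `[a, 1]` below `M`. -/
lemma le_add_integral_ind {M a : ℝ} (ha : a ≤ 1) (hM : M ≤ 1) :
    M ≤ a + ∫ l in a..1, ind (l < M) := by
  rcases le_total M a with h | h
  · have : 0 ≤ ∫ l in a..1, ind (l < M) :=
      intervalIntegral.integral_nonneg ha fun _ _ => ind_nonneg _
    linarith
  · rw [← intervalIntegral.integral_add_adjacent_intervals (intervalIntegrable_ind_lt M a M)
      (intervalIntegrable_ind_lt M M 1)]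
    have h1 : 0 ≤ ∫ l in M..1, ind (l < M) :=
      intervalIntegral.integral_nonneg hM fun _ _ => ind_nonneg _
    have h2 : ∫ l in a..M, ind (l < M) = ∫ _ in a..M, (1 : ℝ) := by
      rw [intervalIntegral.integral_of_le h, intervalIntegral.integral_of_le h,
        MeasureTheory.integral_Ioc_eq_integral_Ioo, MeasureTheory.integral_Ioc_eq_integral_Ioo]
      exact MeasureTheory.setIntegral_congr_fun measurableSet_Ioo fun l hl => ind_of_true hl.2
    rw [h2, intervalIntegral.integral_const]
    simp; linarith

/-- The tail is bounded by 1 below `a` and by Doob's inequality above it; the integral of `1 / l`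
gives the logarithm. -/
lemma mean_maxInf_le_add (f : Cube n → Bool) (c : Fin n → ℝ) (hε : 0 < ε) (hB : 0 < B)
    (hβ : 0 < β) (j : Fin n) {a : ℝ} (ha : 0 < a) (ha1 : a ≤ 1) :
    mean (maxInf f ε B β c j) ≤ a + influence f j * Real.log (1 / a) := by
  have h1 : mean (maxInf f ε B β c j) ≤
      a + ∫ l in a..1, unifPr fun y => l < maxInf f ε B β c j y := by
    have h2 : (∫ l in a..1, unifPr fun y => l < maxInf f ε B β c j y) =
        mean fun y => ∫ l in a..1, ind (l < maxInf f ε B β c j y) := by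
      simp_rw [unifPr_eq_mean, mean]
      rw [intervalIntegral.integral_div, intervalIntegral.integral_finsetSum]
      exact fun y _ => intervalIntegrable_ind_lt _ _ _
    rw [h2]
    refine (mean_mono fun y => le_add_integral_ind ha1 (maxInf_le_one j)).trans (le_of_eq ?_)
    rw [mean_add, mean_const]
  have h3 : (∫ l in a..1, unifPr fun y => l < maxInf f ε B β c j y) ≤
      ∫ l in a..1, influence f j * (1 / l) := by
    refine intervalIntegral.integral_mono_on ha1 ?_ ?_ fun l hl => ?_
    · refine Antitone.intervalIntegrable fun l l' h => ?_
      rw [unifPr_eq_mean, unifPr_eq_mean]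
      exact mean_mono fun y => ind_mono fun h' => h.trans_lt h'
    · refine IntervalIntegrable.const_mul ?_ _
      refine intervalIntegral.intervalIntegrable_one_div (fun l hl => ?_) continuousOn_id
      rw [Set.uIcc_of_le ha1] at hl
      exact (ha.trans_le hl.1).ne'
    · have hl0 : 0 < l := ha.trans_le hl.1
      rw [mul_one_div, le_div_iff₀ hl0, mul_comm]
      exact mul_unifPr_lt_maxInf_le f c hε hB hβ j l
  rw [intervalIntegral.integral_const_mul, integral_one_div_of_pos ha one_pos] at h3
  linarith

/-- The expected maximal influence. -/
theorem mean_maxInf_le (f : Cube n → Bool) (c : Fin n → ℝ) (hε : 0 < ε) (hB : 0 < B)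
    (hβ : 0 < β) (j : Fin n) :
    mean (maxInf f ε B β c j) ≤ influence f j * (1 + Real.log (1 / influence f j)) := by
  rcases (influence_nonneg f j).eq_or_lt with h | h
  · rw [← h, zero_mul]
    refine le_of_forall_pos_le_add fun δ hδ => ?_
    -- For influence 0 the cutoff can tend to 0; otherwise the cutoff is the influence itself.
    have := mean_maxInf_le_add f c hε hB hβ j (a := min δ 1) (by positivity) (min_le_right _ _)
    rw [← h, zero_mul, add_zero] at this
    rw [zero_add]
    exact this.trans (min_le_left _ _)
  · have := mean_maxInf_le_add f c hε hB hβ j h (influence_le_one f j)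
    linarith

end IPRR

/-! ### Runs of Online-Query -/

section OnlineQuery

variable {n : ℕ}

open Classical in
/-- The number of the first `k` samples of round `i` on which IPRR errs. -/
noncomputable def wrongCount (f : Cube n → Bool) (ε β : ℝ) (c : Fin n → ℝ) (ω : Seed n)
    (i k : ℕ) : ℕ :=
  ∑ l ∈ Finset.range k, if iprrOut f ε (2 ^ i) β c (ω (i, l)) ≠ f (ω (i, l)) then 1 else 0

/-- The empirical error of round `i` is small. -/
def Passes (f : Cube n → Bool) (ε β K : ℝ) (c : Fin n → ℝ) (ω : Seed n) (i : ℕ) : Prop :=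
  (wrongCount f ε β c ω i (sampleCount K ε i) : ℝ) / sampleCount K ε i ≤ 3 * ε

/-- Round `i` takes place. -/
def Reaches (f : Cube n → Bool) (ε β K : ℝ) (c : Fin n → ℝ) (ω : Seed n) (i : ℕ) : Prop :=
  1 ≤ i ∧ ∀ i', 1 ≤ i' → i' < i → ¬ Passes f ε β K c ω i'

open Classical in
/-- A bound for the investment in `x_j`, up to one unit. -/
noncomputable def callBound (f : Cube n → Bool) (ε β K : ℝ) (c : Fin n → ℝ) (ω : Seed n)
    (x : Cube n) (j : Fin n) : ℝ≥0∞ :=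
  -- The inner sum pays for the simulated calls of a round; the term added to it pays once for a
  -- possible call on the unknown input.
  ∑' i : ℕ, if Reaches f ε β K c ω i then ENNReal.ofReal (2 ^ i / ε) *
    (∑ l ∈ Finset.range (sampleCount K ε i),
      ENNReal.ofReal (maxInf f ε (2 ^ i) β c j (ω (i, l))) +
        ENNReal.ofReal (maxInf f ε (2 ^ i) β c j x)) else 0

/-- The input of the current call to IPRR. -/
def OQState.input (ω : Seed n) (x : Cube n) (s : OQState n) : Cube n :=
  if s.final then x else ω (s.round, s.done)

/-- The invariant of Online-Query on the input `x`. -/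
structure OQInv (f : Cube n → Bool) (ε β K : ℝ) (c : Fin n → ℝ) (ω : Seed n) (x : Cube n)
    (s : OQState n) (u : Fin n → ℕ) : Prop where
  units_eq : u = s.outer
  known_none : ∀ j, s.known j = none → s.outer j = 0 ∨ β * s.outer j < c j
  -- Real investment stops at revelation, so `outer j` is the least positive number of units that
  -- reveals `x_j`. Later calls can thus be answered exactly without knowing `c j`.
  known_some : ∀ j b, s.known j = some b →
    b = x j ∧ ∀ v : ℕ, 1 ≤ v → (s.outer j ≤ v ↔ c j ≤ β * v)
  inner_le : ∀ j, s.known j = none → s.inner.units j ≤ s.outer j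
  reaches : Reaches f ε β K c ω s.round
  inner_run : ∃ t, s.inner = iprrRun f ε (2 ^ s.round) β c (s.input ω x) t
  sampling : s.final = false → s.done < sampleCount K ε s.round ∧
    s.wrong = wrongCount f ε β c ω s.round s.done
  passes : s.final = true → Passes f ε β K c ω s.round
  bound : ∀ j, ENNReal.ofReal (β * s.outer j) ≤
    ENNReal.ofReal β + callBound f ε β K c ω x j

/-- The ways in which one step of Online-Query makes progress. -/
def OQProgress (f : Cube n → Bool) (ε β K : ℝ) (c : Fin n → ℝ) (ω : Seed n)
    (s s' : OQState n) : Prop :=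
  (s'.round = s.round + 1 ∧ ¬ Passes f ε β K c ω s.round) ∨
  (s'.round = s.round ∧ s.final = false ∧
    (s'.final = true ∨ (s'.final = false ∧ s'.done = s.done + 1))) ∨
  (s'.round = s.round ∧ s'.final = s.final ∧ s'.done = s.done ∧
    ∑ j, s'.inner.units j = ∑ j, s.inner.units j + 1)

variable {f : Cube n → Bool} {ε β K : ℝ} {c : Fin n → ℝ} {ω : Seed n} {x : Cube n}

lemma mul_maxInf_le_callBound {i : ℕ} (hi : Reaches f ε β K c ω i) (j : Fin n) {y : Cube n}
    (hy : y = x ∨ ∃ l < sampleCount K ε i, y = ω (i, l)) :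
    ENNReal.ofReal (2 ^ i / ε) * ENNReal.ofReal (maxInf f ε (2 ^ i) β c j y) ≤
      callBound f ε β K c ω x j := by
  unfold callBound
  refine le_trans ?_ (ENNReal.le_tsum i)
  rw [if_pos hi]
  gcongr
  rcases hy with rfl | ⟨l, hl, rfl⟩
  · exact le_add_self
  · exact le_add_right (Finset.single_le_sum
      (f := fun l => ENNReal.ofReal (maxInf f ε (2 ^ i) β c j (ω (i, l))))
      (fun _ _ => zero_le) (Finset.mem_range.2 hl))

lemma OQInv.input_mem {s : OQState n} {u : Fin n → ℕ} (h : OQInv f ε β K c ω x s u) :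
    s.input ω x = x ∨ ∃ l < sampleCount K ε s.round, s.input ω x = ω (s.round, l) := by
  rcases hf : s.final with _ | _
  · exact Or.inr ⟨s.done, (h.sampling hf).1, by simp [OQState.input, hf]⟩
  · exact Or.inl (by simp [OQState.input, hf])

/-- In each case the response shown to the call is the one a stand-alone IPRR run on its own input
would get, because revelation depends on the costs and not on the bits. -/
lemma OQInv.step_invest (hε : 0 < ε) (hβ : 0 < β)
    {p : OQState n × (Fin n → ℕ)} (h : OQInv f ε β K c ω x p.1 p.2) {j : Fin n}
    (hj : iprrStep f ε (2 ^ p.1.round) β p.1.inner = .invest j (p.1.inner.respond j))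
    (hr : ENNReal.ofReal (ε / 2 ^ p.1.round) ≤ iprrRatio f β p.1.inner j) :
    ∃ p' : OQState n × (Fin n → ℕ), (onlineQuery f ε β K ω).advance β c x p = p' ∧
      OQInv f ε β K c ω x p'.1 p'.2 ∧ OQProgress f ε β K c ω p.1 p'.1 := by
  obtain ⟨s, u⟩ := p
  obtain rfl : u = s.outer := h.units_eq
  simp only at h hj hr ⊢
  obtain ⟨t, ht⟩ := h.inner_run
  set y := s.input ω x with hy
  set inner' := s.inner.respond j
    (if c j ≤ β * (s.inner.units j + 1 : ℕ) then some (y j) else none) with hinner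
  have hrun : inner' = iprrRun f ε (2 ^ s.round) β c y (t + 1) := by
    rw [iprrRun_succ, ← ht, iprrNext_of_invest hj]
  have hsum : ∑ k, inner'.units k = ∑ k, s.inner.units k + 1 := by
    have hh : ¬ IPRRHalted f ε (2 ^ s.round) β s.inner := by
      rintro ⟨b, hb⟩; rw [hj] at hb; cases hb
    rw [← sum_units_next (c := c) (y := y) hh, iprrNext_of_invest hj]
  have hunits : inner'.units = Function.update s.inner.units j (s.inner.units j + 1) := rfl
  have hshown : (if s.final then x j else ω (s.round, s.done) j) = y j := by
    rw [hy, OQState.input]; split_ifs <;> rfl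
  rcases hk : s.known j with _ | b
  · by_cases hv : s.inner.units j + 1 ≤ s.outer j
    · refine ⟨({ s with inner := inner' }, s.outer), ?_, ?_, ?_⟩
      -- The real investment is at least as large and has not revealed `x_j`, so the stand-alone run
      -- sees nothing either.
      · have hc : ¬ c j ≤ β * (s.inner.units j + 1 : ℕ) := by
          rcases h.known_none j hk with h0 | h0
          · omega
          · have : β * (s.inner.units j + 1 : ℕ) ≤ β * s.outer j := by gcongr
            linarith
        refine OnlineAlg.advance_of_think ?_
        change oqStep f ε β K ω s = _
        simp only [oqStep, hj, hk, hv, if_true, hinner, hc, if_false]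
        rfl
      · refine ⟨rfl, h.known_none, h.known_some, fun k hk' => ?_, h.reaches, ⟨_, hrun⟩,
          h.sampling, h.passes, h.bound⟩
        by_cases hkj : k = j
        · subst hkj; simpa [hunits] using hv
        · simpa [hunits, hkj] using h.inner_le k hk'
      · exact Or.inr (Or.inr ⟨rfl, rfl, rfl, hsum⟩)
    · have hle := h.inner_le j hk
      have heq : s.inner.units j = s.outer j := by omega
      set r : Option Bool := if c j ≤ β * (s.outer j + 1 : ℕ) then some (x j) else none with hrdef
      refine ⟨({ s with
          outer := Function.update s.outer j (s.outer j + 1)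
          known := Function.update s.known j r
          inner := inner' }, Function.update s.outer j (s.outer j + 1)), ?_, ?_, ?_⟩
      · refine (OnlineAlg.advance_of_invest (i := j) (next := fun r => { s with
              outer := Function.update s.outer j (s.outer j + 1)
              known := Function.update s.known j r
              inner := s.inner.respond j (r.map fun b =>
                if s.final then b else ω (s.round, s.done) j) }) ?_).trans ?_
        · change oqStep f ε β K ω s = _
          simp only [oqStep, hj, hk, hv, if_false]
          rfl
        · rw [← hrdef]
          congr 2
          rw [hinner, heq]
          congr 1
          rw [hrdef]
          by_cases hc : c j ≤ β * (s.outer j + 1 : ℕ)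
          · simp only [if_pos hc, Option.map_some, hshown]
          · simp only [if_neg hc, Option.map_none]
      · refine ⟨rfl, fun k hk' => ?_, fun k b hb => ?_, fun k hk' => ?_, h.reaches, ⟨_, hrun⟩,
          h.sampling, h.passes, fun k => ?_⟩
        · by_cases hkj : k = j
          · subst hkj
            simp only [Function.update_self] at hk' ⊢
            right
            by_contra! hc
            rw [hrdef, if_pos hc] at hk'
            cases hk'
          · simp only [Function.update_of_ne hkj] at hk' ⊢
            exact h.known_none k hk'
        · by_cases hkj : k = j
          · subst hkj
            simp only [Function.update_self] at hb ⊢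
            by_cases hc : c k ≤ β * (s.outer k + 1 : ℕ)
            · rw [hrdef, if_pos hc] at hb
              refine ⟨(Option.some.inj hb).symm, fun v hv1 => ⟨fun hv2 => ?_, fun hv2 => ?_⟩⟩
              · exact hc.trans (by gcongr)
              -- Minimality of the new value: `outer k` units did not suffice, so neither do `v ≤
              -- outer k` positive units.
              · by_contra! hlt
                rcases h.known_none k hk with h0 | h0
                · omega
                · have : β * (v : ℝ) ≤ β * s.outer k := by
                    gcongr; omega
                  linarith
            · rw [hrdef, if_neg hc] at hb; cases hb
          · simp only [Function.update_of_ne hkj] at hb ⊢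
            exact h.known_some k b hb
        · by_cases hkj : k = j
          · subst hkj; simp [hunits, heq]
          · simp only [Function.update_of_ne hkj, hunits] at hk' ⊢
            exact h.inner_le k hk'
        · by_cases hkj : k = j
          · subst hkj
            simp only [Function.update_self]
            push_cast
            rw [mul_add, mul_one, add_comm, ENNReal.ofReal_add hβ.le (by positivity)]
            refine add_le_add le_rfl
              (le_trans ?_ (mul_maxInf_le_callBound h.reaches k h.input_mem))
            rw [← ENNReal.ofReal_mul (by positivity)]
            refine ENNReal.ofReal_le_ofReal ?_
            rw [← heq]
            -- Before a real unit is added, the call's own investment equals the real one, so the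
            -- threshold rule of the call bounds both.
            refine (units_le_of_ratio_ge hε (by positivity) hβ hr).trans ?_
            refine mul_le_mul_of_nonneg_left ?_ (by positivity)
            rw [ht]
            exact influence_le_maxInf f ε _ β c k _ t
          · simp only [Function.update_of_ne hkj]
            exact h.bound k
      · exact Or.inr (Or.inr ⟨rfl, rfl, rfl, hsum⟩)
  · obtain ⟨rfl, hb⟩ := h.known_some j b hk
    refine ⟨({ s with inner := inner' }, s.outer), ?_, ?_, ?_⟩
    · refine OnlineAlg.advance_of_think ?_
      change oqStep f ε β K ω s = _
      simp only [oqStep, hj, hk, hinner, hb _ (Nat.le_add_left 1 _), hshown]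
      rfl
    · refine ⟨rfl, h.known_none, h.known_some, fun k hk' => ?_, h.reaches, ⟨_, hrun⟩,
        h.sampling, h.passes, h.bound⟩
      by_cases hkj : k = j
      · subst hkj; simp only at hk'; rw [hk] at hk'; cases hk'
      · simpa [hunits, hkj] using h.inner_le k hk'
    · exact Or.inr (Or.inr ⟨rfl, rfl, rfl, hsum⟩)

lemma OQInv.step_return (hm : ∀ i, 1 ≤ i → 0 < sampleCount K ε i)
    {p : OQState n × (Fin n → ℕ)} (h : OQInv f ε β K c ω x p.1 p.2) {b : Bool}
    (hb : iprrStep f ε (2 ^ p.1.round) β p.1.inner = .output b) (hfin : p.1.final = false) :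
    ∃ p' : OQState n × (Fin n → ℕ), (onlineQuery f ε β K ω).advance β c x p = p' ∧
      OQInv f ε β K c ω x p'.1 p'.2 ∧ OQProgress f ε β K c ω p.1 p'.1 := by
  obtain ⟨s, u⟩ := p
  obtain rfl : u = s.outer := h.units_eq
  simp only at h hb hfin ⊢
  obtain ⟨t, ht⟩ := h.inner_run
  have hin : s.input ω x = ω (s.round, s.done) := by simp [OQState.input, hfin]
  rw [ht, hin] at hb
  have hout := iprrOut_eq hb
  rw [← hin, ← ht] at hb
  obtain ⟨hdone, hwrong⟩ := h.sampling hfin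
  have hcount : (s.wrong + if b ≠ f (ω (s.round, s.done)) then 1 else 0) =
      wrongCount f ε β c ω s.round (s.done + 1) := by
    rw [hwrong, wrongCount, wrongCount, Finset.sum_range_succ, hout]
  by_cases hd : s.done + 1 < sampleCount K ε s.round
  · refine ⟨({ s with
        done := s.done + 1
        wrong := wrongCount f ε β c ω s.round (s.done + 1)
        inner := IPRRState.start n }, s.outer), ?_, ?_, ?_⟩
    · refine OnlineAlg.advance_of_think ?_
      change oqStep f ε β K ω s = _
      simp only [oqStep, hb, hfin, hcount, hd, if_true, Bool.false_eq_true, if_false]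
      rfl
    · exact ⟨rfl, h.known_none, h.known_some, fun k _ => Nat.zero_le _, h.reaches, ⟨0, rfl⟩,
        fun _ => ⟨hd, rfl⟩, h.passes, h.bound⟩
    · exact Or.inr (Or.inl ⟨rfl, hfin, Or.inr ⟨hfin, rfl⟩⟩)
  · have hdm : s.done + 1 = sampleCount K ε s.round := by omega
    by_cases hT : (wrongCount f ε β c ω s.round (s.done + 1) : ℝ) /
        sampleCount K ε s.round ≤ 3 * ε
    · have hpass : Passes f ε β K c ω s.round := by
        unfold Passes; rwa [hdm] at hT
      refine ⟨({ s with
          done := s.done + 1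
          wrong := wrongCount f ε β c ω s.round (s.done + 1)
          final := true
          inner := IPRRState.start n }, s.outer), ?_, ?_, ?_⟩
      · refine OnlineAlg.advance_of_think ?_
        change oqStep f ε β K ω s = _
        simp only [oqStep, hb, hfin, hcount, hd, hT, if_true, Bool.false_eq_true, if_false]
        rfl
      · exact ⟨rfl, h.known_none, h.known_some, fun k _ => Nat.zero_le _, h.reaches, ⟨0, rfl⟩,
          fun h' => (by cases h'), fun _ => hpass, h.bound⟩
      · exact Or.inr (Or.inl ⟨rfl, hfin, Or.inl rfl⟩)
    · have hpass : ¬ Passes f ε β K c ω s.round := by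
        unfold Passes; rwa [hdm] at hT
      refine ⟨({ s with
          round := s.round + 1
          done := 0
          wrong := 0
          inner := IPRRState.start n }, s.outer), ?_, ?_, ?_⟩
      · refine OnlineAlg.advance_of_think ?_
        change oqStep f ε β K ω s = _
        simp only [oqStep, hb, hfin, hcount, hd, hT, Bool.false_eq_true, if_false]
        rfl
      · refine ⟨rfl, h.known_none, h.known_some, fun k _ => Nat.zero_le _,
          ⟨Nat.le_add_left _ _, fun i hi1 hi2 => ?_⟩, ⟨0, rfl⟩,
          fun _ => ⟨hm _ (Nat.le_add_left _ _), rfl⟩,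
          fun h' => absurd (hfin.symm.trans h') (by simp), h.bound⟩
        rcases Nat.lt_succ_iff_lt_or_eq.1 hi2 with h2 | h2
        · exact h.reaches.2 i hi1 h2
        · rw [h2]; exact hpass
      · exact Or.inl ⟨rfl, hpass⟩

lemma OQInv.step (hε : 0 < ε) (hβ : 0 < β) (hm : ∀ i, 1 ≤ i → 0 < sampleCount K ε i)
    {p : OQState n × (Fin n → ℕ)} (h : OQInv f ε β K c ω x p.1 p.2) :
    (∃ b, oqStep f ε β K ω p.1 = .output b ∧ Passes f ε β K c ω p.1.round ∧
      b = iprrOut f ε (2 ^ p.1.round) β c x) ∨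
    ∃ p' : OQState n × (Fin n → ℕ), (onlineQuery f ε β K ω).advance β c x p = p' ∧
      OQInv f ε β K c ω x p'.1 p'.2 ∧ OQProgress f ε β K c ω p.1 p'.1 := by
  rcases iprrStep_cases f ε (2 ^ p.1.round) β p.1.inner with ⟨hb, -⟩ | ⟨j, hj, hr⟩
  · rcases hfin : p.1.final with _ | _
    · exact Or.inr (h.step_return hm hb hfin)
    · left
      refine ⟨roundedMean f p.1.inner.π, ?_, h.passes hfin, ?_⟩
      · simp only [oqStep, hb, hfin, if_true]
      · obtain ⟨t, ht⟩ := h.inner_run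
        have hin : p.1.input ω x = x := by simp [OQState.input, hfin]
        rw [hin] at ht
        rw [ht] at hb ⊢
        exact (iprrOut_eq hb).symm
  · exact Or.inr (h.step_invest hε hβ hj hr)

lemma oqInv_init (hm : ∀ i, 1 ≤ i → 0 < sampleCount K ε i) :
    OQInv f ε β K c ω x (onlineQuery f ε β K ω).init 0 :=
  ⟨rfl, fun _ _ => Or.inl rfl, fun j b h => (by cases h), fun _ _ => le_rfl,
    ⟨le_rfl, fun i h1 h2 => by
      change i < 1 at h2
      omega⟩, ⟨0, rfl⟩,
    fun _ => ⟨hm 1 le_rfl, rfl⟩, fun h => (by cases h), fun j => by simp [onlineQuery]⟩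

lemma oqInv_run (hε : 0 < ε) (hβ : 0 < β) (hm : ∀ i, 1 ≤ i → 0 < sampleCount K ε i) (t : ℕ) :
    OQInv f ε β K c ω x ((onlineQuery f ε β K ω).run β c x t).1
      ((onlineQuery f ε β K ω).run β c x t).2 := by
  induction t with
  | zero => exact oqInv_init hm
  | succ t ih =>
    rw [OnlineAlg.run_succ]
    rcases OQInv.step hε hβ hm ih with ⟨b, hb, -⟩ | ⟨p', hp', h1, -⟩
    · rw [OnlineAlg.advance_of_output (b := b) hb]; exact ih
    · rw [hp']; exact h1

/-- The cost of Online-Query. -/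
theorem oq_cost_le (hε : 0 < ε) (hβ : 0 < β) (hm : ∀ i, 1 ≤ i → 0 < sampleCount K ε i) :
    (onlineQuery f ε β K ω).cost β c x ≤
      ENNReal.ofReal (β * n) + ∑ j, callBound f ε β K c ω x j := by
  unfold OnlineAlg.cost
  refine iSup_le fun t => ?_
  have h := oqInv_run (f := f) (c := c) (ω := ω) (x := x) hε hβ hm t
  rw [ENNReal.ofReal_sum_of_nonneg fun i _ => by positivity]
  calc _ ≤ ∑ j, (ENNReal.ofReal β + callBound f ε β K c ω x j) := by
        refine Finset.sum_le_sum fun j _ => ?_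
        rw [h.units_eq]; exact h.bound j
    _ = _ := by
        rw [Finset.sum_add_distrib]
        congr 1
        rw [mul_comm, ENNReal.ofReal_mul (by positivity)]
        simp

/-- A cap, as a natural number, on the steps of one call; it serves as the last component of the
termination measure. -/
lemma sum_units_run_le (hε : 0 < ε) (hβ : 0 < β) (i : ℕ) (y : Cube n) (t : ℕ) :
    ∑ j, (iprrRun f ε (2 ^ i) β c y t).units j ≤ ⌈n * (β + 2 ^ i / ε) / β⌉₊ := by
  have h : (∑ j, (iprrRun f ε (2 ^ i) β c y t).units j : ℝ) ≤ n * (β + 2 ^ i / ε) / β := by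
    rw [le_div_iff₀ hβ, Finset.sum_mul]
    refine (Finset.sum_le_sum fun j _ => ?_).trans (b := ∑ _j : Fin n, (β + 2 ^ i / ε))
      (by simp [mul_add])
    rw [mul_comm]
    exact (iprrValid_run hε (by positivity) hβ t).units_le j
  exact_mod_cast h.trans (Nat.le_ceil _)

/-- Each step that does not halt lowers, lexicographically, the rounds left before round `i`, then
the calls left in the round, then the investments left in the call. Halting requires the current
round to pass, so it happens in round `i`. -/
lemma OQInv.outputs (hε : 0 < ε) (hβ : 0 < β) (hm : ∀ i, 1 ≤ i → 0 < sampleCount K ε i)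
    {i : ℕ} (hi : 1 ≤ i) (hpass : Passes f ε β K c ω i)
    (hfirst : ∀ i', 1 ≤ i' → i' < i → ¬ Passes f ε β K c ω i')
    (p : OQState n × (Fin n → ℕ)) (h : OQInv f ε β K c ω x p.1 p.2) :
    ∃ t, oqStep f ε β K ω (((onlineQuery f ε β K ω).advance β c x)^[t] p).1 =
      .output (iprrOut f ε (2 ^ i) β c x) := by
  have hle : ∀ s u, OQInv f ε β K c ω x s u → s.round ≤ i := fun s u hs => by
    by_contra! hlt
    exact hs.reaches.2 i hi hlt hpass
  rcases h.step hε hβ hm with ⟨b, hb, h1, rfl⟩ | ⟨p', hp', hinv, hprog⟩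
  · have : p.1.round = i := by
      by_contra hne
      exact hfirst _ h.reaches.1 (lt_of_le_of_ne (hle _ _ h) hne) h1
    rw [← this]
    exact ⟨0, hb⟩
  · have hdec : Prod.Lex (· < ·) (Prod.Lex (· < ·) (· < ·))
        (i - p'.1.round, (if p'.1.final then 0 else 1 + (sampleCount K ε p'.1.round - p'.1.done)),
          ⌈n * (β + 2 ^ p'.1.round / ε) / β⌉₊ - ∑ j, p'.1.inner.units j)
        (i - p.1.round, (if p.1.final then 0 else 1 + (sampleCount K ε p.1.round - p.1.done)),
          ⌈n * (β + 2 ^ p.1.round / ε) / β⌉₊ - ∑ j, p.1.inner.units j) := by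
      rcases hprog with ⟨h1, -⟩ | ⟨h1, h2, h3⟩ | ⟨h1, h2, h3, h4⟩
      · have := hle _ _ hinv
        exact Prod.Lex.left _ _ (by omega)
      · rw [h1]
        refine Prod.Lex.right _ (Prod.Lex.left _ _ ?_)
        rcases h3 with h3 | ⟨h3, h4⟩
        · simp [h2, h3]
        · have := (h.sampling h2).1
          simp only [h2, h3, h4, Bool.false_eq_true, if_false]
          omega
      · rw [h1, h2, h3]
        refine Prod.Lex.right _ (Prod.Lex.right _ ?_)
        obtain ⟨t, ht⟩ := hinv.inner_run
        have h5 := sum_units_run_le (f := f) (c := c) hε hβ p'.1.round (p'.1.input ω x) t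
        rw [← ht, h4, h1] at h5
        rw [h4]
        omega
    obtain ⟨t, ht⟩ := OQInv.outputs hε hβ hm hi hpass hfirst p' hinv
    refine ⟨t + 1, ?_⟩
    subst hp'
    exact ht
termination_by (i - p.1.round,
  (if p.1.final then 0 else 1 + (sampleCount K ε p.1.round - p.1.done)),
  ⌈n * (β + 2 ^ p.1.round / ε) / β⌉₊ - ∑ j, p.1.inner.units j)
decreasing_by exact hdec

/-- Online-Query returns the output of IPRR in the first round that passes. -/
theorem oq_outputs (hε : 0 < ε) (hβ : 0 < β) (hm : ∀ i, 1 ≤ i → 0 < sampleCount K ε i)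
    {i : ℕ} (hi : Reaches f ε β K c ω i) (hpass : Passes f ε β K c ω i) :
    (onlineQuery f ε β K ω).Outputs β c x (iprrOut f ε (2 ^ i) β c x) :=
  OQInv.outputs hε hβ hm hi.1 hpass hi.2 ((onlineQuery f ε β K ω).init, 0) (oqInv_init hm)

end OnlineQuery

/-! ### Products of independent samples -/

section Seed

variable {n : ℕ}

instance : MeasureTheory.IsProbabilityMeasure (seedMeasure n) := by
  unfold seedMeasure; infer_instance

lemma lintegral_uniform_ofReal {g : Cube n → ℝ} (hg : ∀ y, 0 ≤ g y) :
    ∫⁻ y, ENNReal.ofReal (g y) ∂(PMF.uniformOfFintype (Cube n)).toMeasure =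
      ENNReal.ofReal (mean g) := by
  classical
  rw [MeasureTheory.lintegral_fintype]
  have h : ∀ y : Cube n, (PMF.uniformOfFintype (Cube n)).toMeasure {y} = (2 ^ n)⁻¹ := by
    intro y
    rw [PMF.toMeasure_apply_singleton _ _ (MeasurableSet.singleton y)]
    simp
  simp_rw [h]
  rw [← Finset.sum_mul, ← ENNReal.ofReal_sum_of_nonneg fun y _ => hg y, mean,
    ENNReal.ofReal_div_of_pos (by positivity), ENNReal.ofReal_pow (by norm_num)]
  simp [ENNReal.div_eq_inv_mul, mul_comm]

lemma measurable_sample (g : Cube n → ℝ≥0∞) (k : ℕ × ℕ) :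
    Measurable fun ω : Seed n => g (ω k) :=
  (Measurable.of_discrete (f := g)).comp (measurable_pi_apply k)

lemma lintegral_seed_prod (S : Finset (ℕ × ℕ)) {g : ℕ × ℕ → Cube n → ℝ}
    (hg : ∀ k y, 0 ≤ g k y) :
    ∫⁻ ω, ∏ k ∈ S, ENNReal.ofReal (g k (ω k)) ∂seedMeasure n =
      ∏ k ∈ S, ENNReal.ofReal (mean (g k)) := by
  have hind : ProbabilityTheory.iIndepFun
      (fun (k : ℕ × ℕ) (ω : Seed n) => ENNReal.ofReal (g k (ω k))) (seedMeasure n) :=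
    ProbabilityTheory.iIndepFun_infinitePi (X := fun k y => ENNReal.ofReal (g k y))
      fun k => Measurable.of_discrete
  rw [ProbabilityTheory.lintegral_prod_eq_prod_lintegral_of_indepFun S _ hind
    fun k => measurable_sample (fun y => ENNReal.ofReal (g k y)) k]
  refine Finset.prod_congr rfl fun k _ => ?_
  rw [← lintegral_uniform_ofReal (hg k)]
  have hmp := measurePreserving_eval_infinitePi
    (fun _ : ℕ × ℕ => (PMF.uniformOfFintype (Cube n)).toMeasure) k
  exact hmp.lintegral_comp (f := fun y => ENNReal.ofReal (g k y)) Measurable.of_discrete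

/-- The product of the weights `g i` of the first `m i` samples of the rounds `i ∈ I`. -/
noncomputable def roundProd (I : Finset ℕ) (m : ℕ → ℕ) (g : ℕ → Cube n → ℝ) (ω : Seed n) :
    ℝ≥0∞ :=
  ∏ i ∈ I, ∏ l ∈ Finset.range (m i), ENNReal.ofReal (g i (ω (i, l)))

lemma measurable_roundProd (I : Finset ℕ) (m : ℕ → ℕ) (g : ℕ → Cube n → ℝ) :
    Measurable (roundProd I m g) := by
  unfold roundProd
  exact Finset.measurable_fun_prod _ fun i _ => Finset.measurable_fun_prod _ fun l _ =>
    measurable_sample (fun y => ENNReal.ofReal (g i y)) (i, l)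

lemma roundProd_eq (I : Finset ℕ) (m : ℕ → ℕ) (g : ℕ → Cube n → ℝ) (ω : Seed n) :
    roundProd I m g ω = ∏ k ∈ (I.sigma fun i => Finset.range (m i)).map
      (Equiv.sigmaEquivProd ℕ ℕ).toEmbedding, ENNReal.ofReal (g k.1 (ω k)) := by
  rw [Finset.prod_map, Finset.prod_sigma]
  rfl

/-- A sample of a round outside `I` is independent of the product. This separates the chance of
reaching a round from the cost incurred in it. -/
lemma lintegral_roundProd_mul (I : Finset ℕ) (m : ℕ → ℕ) {g : ℕ → Cube n → ℝ}
    (hg : ∀ i y, 0 ≤ g i y) {h : Cube n → ℝ} (hh : ∀ y, 0 ≤ h y) {k : ℕ × ℕ} (hk : k.1 ∉ I) :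
    ∫⁻ ω, roundProd I m g ω * ENNReal.ofReal (h (ω k)) ∂seedMeasure n =
      (∏ i ∈ I, ENNReal.ofReal (mean (g i)) ^ m i) * ENNReal.ofReal (mean h) := by
  classical
  set S := (I.sigma fun i => Finset.range (m i)).map (Equiv.sigmaEquivProd ℕ ℕ).toEmbedding with hS
  have hkS : k ∉ S := by
    intro hmem
    rw [hS, Finset.mem_map] at hmem
    obtain ⟨a, ha, rfl⟩ := hmem
    exact hk (Finset.mem_sigma.1 ha).1
  -- The extra factor is treated as one more sample weight, so that a single product formula
  -- applies.
  set g' : ℕ × ℕ → Cube n → ℝ := Function.update (fun k => g k.1) k h with hg'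
  have hne : ∀ k' ∈ S, g' k' = g k'.1 := fun k' hk' =>
    Function.update_of_ne (ne_of_mem_of_not_mem hk' hkS) _ _
  have hself : g' k = h := Function.update_self _ _ _
  have key := lintegral_seed_prod (insert k S) (g := g') fun k' y => by
    by_cases hkk : k' = k
    · subst hkk; rw [hself]; exact hh y
    · rw [hg', Function.update_of_ne hkk]; exact hg _ y
  simp_rw [Finset.prod_insert hkS, hself] at key
  have h1 : ∀ ω : Seed n, ∏ k' ∈ S, ENNReal.ofReal (g' k' (ω k')) = roundProd I m g ω := by
    intro ω
    rw [roundProd_eq]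
    exact Finset.prod_congr rfl fun k' hk' => by rw [hne k' hk']
  have h2 : ∏ k' ∈ S, ENNReal.ofReal (mean (g' k')) =
      ∏ i ∈ I, ENNReal.ofReal (mean (g i)) ^ m i := by
    rw [hS, Finset.prod_map, Finset.prod_sigma]
    refine Finset.prod_congr rfl fun i hi => ?_
    rw [← Finset.card_range (m i), ← Finset.prod_const, Finset.card_range]
    refine Finset.prod_congr rfl fun l hl => ?_
    rw [hne]
    · rfl
    · rw [hS]
      exact Finset.mem_map_of_mem _ (Finset.mem_sigma.2 ⟨hi, hl⟩)
  simp_rw [h1, h2] at key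
  simp_rw [mul_comm (roundProd I m g _)]
  rw [key, mul_comm]

lemma lintegral_roundProd (I : Finset ℕ) (m : ℕ → ℕ) {g : ℕ → Cube n → ℝ}
    (hg : ∀ i y, 0 ≤ g i y) :
    ∫⁻ ω, roundProd I m g ω ∂seedMeasure n = ∏ i ∈ I, ENNReal.ofReal (mean (g i)) ^ m i := by
  obtain ⟨k, hk⟩ := Infinite.exists_notMem_finset I
  have := lintegral_roundProd_mul I m hg (h := fun _ => 1) (fun _ => zero_le_one)
    (k := (k, 0)) hk
  simpa [mean_const] using this

end Seed

/-! ### Concentration of the empirical error -/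

section Concentration

variable {n : ℕ} {f : Cube n → Bool} {ε β K : ℝ} {c : Fin n → ℝ} {ω : Seed n}

/-- The error of `IPRR(f, ε, 2 ^ i)`. -/
noncomputable def iprrErr (f : Cube n → Bool) (ε β : ℝ) (c : Fin n → ℝ) (i : ℕ) : ℝ :=
  unifPr fun y => iprrOut f ε (2 ^ i) β c y ≠ f y

/-- The weight of a sample in the bound for the upper tail of the empirical error. -/
noncomputable def upperWeight (f : Cube n → Bool) (ε β : ℝ) (c : Fin n → ℝ) (i : ℕ)
    (y : Cube n) : ℝ :=
  Real.exp ((ind (iprrOut f ε (2 ^ i) β c y ≠ f y) - 3 * ε) / 2)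

/-- The weight of a sample in the bound for the lower tail of the empirical error. -/
noncomputable def lowerWeight (f : Cube n → Bool) (ε β : ℝ) (c : Fin n → ℝ) (i : ℕ)
    (y : Cube n) : ℝ :=
  Real.exp (3 * ε - ind (iprrOut f ε (2 ^ i) β c y ≠ f y))

lemma upperWeight_nonneg (f : Cube n → Bool) (ε β : ℝ) (c : Fin n → ℝ) (i : ℕ) (y : Cube n) :
    0 ≤ upperWeight f ε β c i y := (Real.exp_pos _).le

lemma lowerWeight_nonneg (f : Cube n → Bool) (ε β : ℝ) (c : Fin n → ℝ) (i : ℕ) (y : Cube n) :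
    0 ≤ lowerWeight f ε β c i y := (Real.exp_pos _).le

lemma mean_one_add (a : ℝ) (g : Cube n → ℝ) : 1 + a * mean g = mean fun y => 1 + a * g y := by
  rw [mean_add, mean_const, mean_const_mul]

lemma exp_mul_ind (a : ℝ) (p : Prop) : Real.exp (a * ind p) = 1 + (Real.exp a - 1) * ind p := by
  by_cases hp : p
  · rw [ind_of_true hp]; simp
  · rw [ind_of_false hp]; simp

lemma exp_half_le : Real.exp (1 / 2) ≤ 1.65 := by
  have h : Real.exp (1 / 2) ^ 2 ≤ 1.65 ^ 2 := by
    rw [← Real.exp_nat_mul]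
    have := Real.exp_one_lt_d9
    norm_num at this ⊢
    linarith
  exact le_of_sq_le_sq h (by norm_num)

/-- Chernoff bound with parameter 1/2: the exponent is at most −1.5ε + 0.65·2ε = −ε/5. -/
lemma mean_upperWeight_le {i : ℕ} (h : iprrErr f ε β c i ≤ 2 * ε) :
    mean (upperWeight f ε β c i) ≤ Real.exp (-(ε / 5)) := by
  have h1 : mean (upperWeight f ε β c i) =
      Real.exp (-(3 * ε / 2)) * (1 + (Real.exp (1 / 2) - 1) * iprrErr f ε β c i) := by
    rw [iprrErr, unifPr_eq_mean, mean_one_add, ← mean_const_mul]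
    refine mean_congr fun y => ?_
    rw [← exp_mul_ind, ← Real.exp_add, upperWeight]
    congr 1; ring
  have h0 : 0 ≤ iprrErr f ε β c i := unifPr_nonneg _
  have h2 : (Real.exp (1 / 2) - 1) * iprrErr f ε β c i ≤ 0.65 * (2 * ε) :=
    mul_le_mul (by linarith [exp_half_le]) h h0 (by norm_num)
  have h3 := Real.add_one_le_exp (1.3 * ε)
  calc _ ≤ Real.exp (-(3 * ε / 2)) * Real.exp (1.3 * ε) := by
        rw [h1]
        refine mul_le_mul_of_nonneg_left ?_ (Real.exp_pos _).le
        linarith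
    _ = _ := by rw [← Real.exp_add]; congr 1; ring

/-- Chernoff bound with parameter 1: since 1 − 1/e ≥ 1/2, an error of at least 12ε gives an exponent
of at most 3ε − 6ε. -/
lemma mean_lowerWeight_le {i : ℕ} (hε : 0 < ε) (h : 12 * ε ≤ iprrErr f ε β c i) :
    mean (lowerWeight f ε β c i) ≤ Real.exp (-(3 * ε)) := by
  have h1 : mean (lowerWeight f ε β c i) =
      Real.exp (3 * ε) * (1 + (Real.exp (-1) - 1) * iprrErr f ε β c i) := by
    rw [iprrErr, unifPr_eq_mean, mean_one_add, ← mean_const_mul]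
    refine mean_congr fun y => ?_
    rw [← exp_mul_ind, ← Real.exp_add, lowerWeight]
    congr 1; ring
  have h4 : Real.exp (-1) ≤ 1 / 2 := by
    rw [Real.exp_neg, inv_eq_one_div]
    exact one_div_le_one_div_of_le (by norm_num) (by linarith [Real.add_one_le_exp 1])
  have h2 : (Real.exp (-1) - 1) * iprrErr f ε β c i ≤ -(6 * ε) := by nlinarith
  have h3 := Real.add_one_le_exp (-(6 * ε))
  calc _ ≤ Real.exp (3 * ε) * Real.exp (-(6 * ε)) := by
        rw [h1]
        refine mul_le_mul_of_nonneg_left ?_ (Real.exp_pos _).le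
        linarith
    _ = _ := by rw [← Real.exp_add]; congr 1; ring

lemma wrongCount_eq (i k : ℕ) : (wrongCount f ε β c ω i k : ℝ) =
    ∑ l ∈ Finset.range k, ind (iprrOut f ε (2 ^ i) β c (ω (i, l)) ≠ f (ω (i, l))) := by
  unfold wrongCount ind
  push_cast
  exact Finset.sum_congr rfl fun l _ => by congr

/-- The logarithm of the product is half the excess of the wrong count over 3ε times the number of
samples, so the product dominates the indicator of failure. -/
lemma one_le_prod_upperWeight {i : ℕ} (hm : 0 < sampleCount K ε i)
    (h : ¬ Passes f ε β K c ω i) :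
    1 ≤ ∏ l ∈ Finset.range (sampleCount K ε i),
      ENNReal.ofReal (upperWeight f ε β c i (ω (i, l))) := by
  rw [← ENNReal.ofReal_prod_of_nonneg fun l _ => upperWeight_nonneg f ε β c i _]
  unfold upperWeight
  rw [← Real.exp_sum, ENNReal.one_le_ofReal, Real.one_le_exp_iff, ← Finset.sum_div,
    Finset.sum_sub_distrib, ← wrongCount_eq]
  unfold Passes at h
  rw [not_le, lt_div_iff₀ (by exact_mod_cast hm)] at h
  simp only [Finset.sum_const, Finset.card_range, nsmul_eq_mul]
  linarith

lemma one_le_prod_lowerWeight {i : ℕ} (hm : 0 < sampleCount K ε i) (h : Passes f ε β K c ω i) :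
    1 ≤ ∏ l ∈ Finset.range (sampleCount K ε i),
      ENNReal.ofReal (lowerWeight f ε β c i (ω (i, l))) := by
  rw [← ENNReal.ofReal_prod_of_nonneg fun l _ => lowerWeight_nonneg f ε β c i _]
  unfold lowerWeight
  rw [← Real.exp_sum, ENNReal.one_le_ofReal, Real.one_le_exp_iff,
    Finset.sum_sub_distrib, ← wrongCount_eq]
  unfold Passes at h
  rw [div_le_iff₀ (by exact_mod_cast hm)] at h
  simp only [Finset.sum_const, Finset.card_range, nsmul_eq_mul]
  linarith

lemma one_le_logb (hε : 0 < ε) (hε2 : ε ≤ 1 / 2) {i : ℕ} (hi : 1 ≤ i) :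
    1 ≤ Real.logb 2 (i / ε) := by
  rw [Real.le_logb_iff_rpow_le (by norm_num) (by positivity), Real.rpow_one, le_div_iff₀ hε]
  have : (1 : ℝ) ≤ i := by exact_mod_cast hi
  linarith

lemma le_mul_sampleCount (hε : 0 < ε) (i : ℕ) :
    K * Real.logb 2 (i / ε) ≤ ε * sampleCount K ε i := by
  have h := Nat.le_ceil (K / ε * Real.logb 2 (i / ε))
  calc K * Real.logb 2 (i / ε) = ε * (K / ε * Real.logb 2 (i / ε)) := by field_simp
    _ ≤ _ := mul_le_mul_of_nonneg_left h hε.le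

lemma sampleCount_pos (hK : 15 ≤ K) (hε : 0 < ε) (hε2 : ε ≤ 1 / 2) {i : ℕ} (hi : 1 ≤ i) :
    0 < sampleCount K ε i := by
  have h := one_le_logb hε hε2 hi
  unfold sampleCount
  rw [Nat.ceil_pos]
  positivity

/-- The source of the constant 15: ε·m_i ≥ K·log(i/ε) ≥ 15, and exp(−15/5) ≤ 1/8. The value 1/8
beats two factors 2 per round in the cost. -/
lemma pow_mean_upperWeight_le (hK : 15 ≤ K) (hε : 0 < ε) (hε2 : ε ≤ 1 / 2) {i : ℕ} (hi : 1 ≤ i)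
    (h : iprrErr f ε β c i ≤ 2 * ε) :
    ENNReal.ofReal (mean (upperWeight f ε β c i)) ^ sampleCount K ε i ≤
      ENNReal.ofReal (1 / 8) := by
  have h0 : 0 ≤ mean (upperWeight f ε β c i) := mean_nonneg fun _ => (Real.exp_pos _).le
  rw [← ENNReal.ofReal_pow h0]
  refine ENNReal.ofReal_le_ofReal ((pow_le_pow_left₀ h0 (mean_upperWeight_le h) _).trans ?_)
  rw [← Real.exp_nat_mul]
  have h1 := le_mul_sampleCount (K := K) hε i
  have h2 := one_le_logb hε hε2 hi
  have h3 : 15 ≤ ε * sampleCount K ε i := by nlinarith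
  have h4 : Real.exp (-3) ≤ 1 / 8 := by
    rw [Real.exp_neg, inv_eq_one_div]
    refine one_div_le_one_div_of_le (by norm_num) ?_
    have h5 : (2 : ℝ) ^ 3 ≤ Real.exp 1 ^ 3 :=
      pow_le_pow_left₀ (by norm_num) (by linarith [Real.add_one_le_exp 1]) 3
    rw [← Real.exp_nat_mul] at h5
    norm_num at h5
    exact h5
  refine le_trans (Real.exp_le_exp.2 ?_) h4
  linarith

/-- The logarithm in the number of samples turns the exponential into at most (ε/i)². This is
summable over the rounds with total O(ε). -/
lemma pow_mean_lowerWeight_le (hK : 15 ≤ K) (hε : 0 < ε) (hε2 : ε ≤ 1 / 2) {i : ℕ} (hi : 1 ≤ i)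
    (h : 12 * ε ≤ iprrErr f ε β c i) :
    ENNReal.ofReal (mean (lowerWeight f ε β c i)) ^ sampleCount K ε i ≤
      ENNReal.ofReal (ε * (1 / (i : ℝ) ^ 2)) := by
  have h0 : 0 ≤ mean (lowerWeight f ε β c i) := mean_nonneg fun _ => (Real.exp_pos _).le
  rw [← ENNReal.ofReal_pow h0]
  refine ENNReal.ofReal_le_ofReal ((pow_le_pow_left₀ h0 (mean_lowerWeight_le hε h) _).trans ?_)
  rw [← Real.exp_nat_mul]
  have h1 := le_mul_sampleCount (K := K) hε i
  have h2 := one_le_logb hε hε2 hi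
  have hi' : (1 : ℝ) ≤ i := by exact_mod_cast hi
  have hpos : 0 < i / ε := by positivity
  have h3 : Real.log (i / ε) ≤ Real.logb 2 (i / ε) := by
    rw [Real.logb, le_div_iff₀ (Real.log_pos (by norm_num))]
    have : 0 ≤ Real.log (i / ε) := Real.log_nonneg (by rw [le_div_iff₀ hε]; linarith)
    have h5 : Real.log 2 ≤ 1 := by linarith [Real.log_two_lt_d9]
    nlinarith
  have h4 : (sampleCount K ε i : ℝ) * -(3 * ε) ≤ (2 : ℕ) * -Real.log (i / ε) := by
    push_cast
    nlinarith
  refine (Real.exp_le_exp.2 h4).trans ?_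
  rw [Real.exp_nat_mul, Real.exp_neg, Real.exp_log hpos, inv_div, div_pow]
  rw [mul_one_div]
  gcongr
  nlinarith

/-- Reaching round `i` means that all earlier rounds failed. The product that dominates this event
uses only samples of rounds before `i`. -/
lemma one_le_roundProd_of_reaches (hm : ∀ i, 1 ≤ i → 0 < sampleCount K ε i) {i₀ i : ℕ} (hi₀ : 1 ≤ i₀)
    (h : Reaches f ε β K c ω i) :
    1 ≤ roundProd (Finset.Ico i₀ i) (sampleCount K ε) (upperWeight f ε β c) ω := by
  unfold roundProd
  refine Finset.one_le_prod' fun i' hi' => ?_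
  have h1 := Finset.mem_Ico.1 hi'
  exact one_le_prod_upperWeight (hm i' (hi₀.trans h1.1)) (h.2 i' (hi₀.trans h1.1) h1.2)

lemma prod_pow_mean_upperWeight_le (hK : 15 ≤ K) (hε : 0 < ε) (hε2 : ε ≤ 1 / 2) {i₀ : ℕ}
    (hi₀ : 1 ≤ i₀) (h : ∀ i, i₀ ≤ i → iprrErr f ε β c i ≤ 2 * ε) (i : ℕ) :
    ∏ i' ∈ Finset.Ico i₀ i, ENNReal.ofReal (mean (upperWeight f ε β c i')) ^
      sampleCount K ε i' ≤ ENNReal.ofReal (1 / 8) ^ (i - i₀) := by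
  rw [← Nat.card_Ico, ← Finset.prod_const]
  refine Finset.prod_le_prod' fun i' hi' => ?_
  have h1 := Finset.mem_Ico.1 hi'
  exact pow_mean_upperWeight_le hK hε hε2 (hi₀.trans h1.1) (h i' h1.1)

lemma measure_reaches_le (hK : 15 ≤ K) (hε : 0 < ε) (hε2 : ε ≤ 1 / 2) {i₀ : ℕ}
    (hi₀ : 1 ≤ i₀) (h : ∀ i, i₀ ≤ i → iprrErr f ε β c i ≤ 2 * ε) (i : ℕ) :
    seedMeasure n {ω | Reaches f ε β K c ω i} ≤ ENNReal.ofReal (1 / 8) ^ (i - i₀) := by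
  have h1 : seedMeasure n {ω | Reaches f ε β K c ω i} ≤ seedMeasure n {ω | 1 ≤
      roundProd (Finset.Ico i₀ i) (sampleCount K ε) (upperWeight f ε β c) ω} :=
    MeasureTheory.measure_mono fun ω hω =>
      one_le_roundProd_of_reaches (fun i hi => sampleCount_pos hK hε hε2 hi) hi₀ hω
  refine h1.trans ?_
  have h2 := MeasureTheory.mul_meas_ge_le_lintegral (μ := seedMeasure n)
    (measurable_roundProd (Finset.Ico i₀ i) (sampleCount K ε) (upperWeight f ε β c)) 1
  rw [one_mul, lintegral_roundProd _ _ (upperWeight_nonneg f ε β c)] at h2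
  exact h2.trans (prod_pow_mean_upperWeight_le hK hε hε2 hi₀ h i)

lemma measure_passes_le (hK : 15 ≤ K) (hε : 0 < ε) (hε2 : ε ≤ 1 / 2) {i : ℕ}
    (hi : 1 ≤ i) (h : 12 * ε ≤ iprrErr f ε β c i) :
    seedMeasure n {ω | Passes f ε β K c ω i} ≤ ENNReal.ofReal (ε * (1 / (i : ℝ) ^ 2)) := by
  have h1 : seedMeasure n {ω | Passes f ε β K c ω i} ≤ seedMeasure n {ω | 1 ≤
      roundProd {i} (sampleCount K ε) (lowerWeight f ε β c) ω} :=
    MeasureTheory.measure_mono fun ω hω => by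
      change 1 ≤ roundProd {i} (sampleCount K ε) (lowerWeight f ε β c) ω
      rw [roundProd, Finset.prod_singleton]
      exact one_le_prod_lowerWeight (sampleCount_pos hK hε hε2 hi) hω
  refine h1.trans ?_
  have h2 := MeasureTheory.mul_meas_ge_le_lintegral (μ := seedMeasure n)
    (measurable_roundProd {i} (sampleCount K ε) (lowerWeight f ε β c)) 1
  rw [one_mul, lintegral_roundProd _ _ (lowerWeight_nonneg f ε β c), Finset.prod_singleton] at h2
  exact h2.trans (pow_mean_lowerWeight_le hK hε hε2 hi h)

lemma measurableSet_passes (f : Cube n → Bool) (ε β K : ℝ) (c : Fin n → ℝ) (i : ℕ) :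
    MeasurableSet {ω : Seed n | Passes f ε β K c ω i} := by
  classical
  have h : Measurable fun ω : Seed n => wrongCount f ε β c ω i (sampleCount K ε i) := by
    unfold wrongCount
    refine Finset.measurable_sum _ fun l _ => ?_
    exact (Measurable.of_discrete (f := fun y : Cube n =>
      if iprrOut f ε (2 ^ i) β c y ≠ f y then 1 else 0)).comp (measurable_pi_apply (i, l))
  exact h (MeasurableSet.of_discrete (s := {w : ℕ | (w : ℝ) / sampleCount K ε i ≤ 3 * ε}))

lemma measurableSet_reaches (f : Cube n → Bool) (ε β K : ℝ) (c : Fin n → ℝ) (i : ℕ) :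
    MeasurableSet {ω : Seed n | Reaches f ε β K c ω i} := by
  have h : {ω : Seed n | Reaches f ε β K c ω i} = {_ω : Seed n | 1 ≤ i} ∩
      ⋂ i' ∈ Set.Ico 1 i, {ω : Seed n | Passes f ε β K c ω i'}ᶜ := by
    ext ω
    simp [Reaches]
  rw [h]
  exact (MeasurableSet.const _).inter (MeasurableSet.biInter (Set.to_countable _)
    fun i' _ => (measurableSet_passes f ε β K c i').compl)

lemma iprrErr_le_of_optAvg_le (hε : 0 < ε) (hβ : 0 < β) (hc : ∀ i, 0 ≤ c i) {i : ℕ}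
    (h : optAvg f c ε ≤ 2 ^ i) : iprrErr f ε β c i ≤ 2 * ε := by
  refine (iprr_error_le hε (by positivity) hβ hc).trans ?_
  have : ε / 2 ^ i * optAvg f c ε ≤ ε / 2 ^ i * 2 ^ i :=
    mul_le_mul_of_nonneg_left h (by positivity)
  rw [div_mul_cancel₀ _ (by positivity)] at this
  linarith

/-! ### The error of Online-Query -/

/-- The event that round `i` is the first to pass. -/
def firstPass (f : Cube n → Bool) (ε β K : ℝ) (c : Fin n → ℝ) (i : ℕ) : Set (Seed n) :=
  {ω | Reaches f ε β K c ω i} ∩ {ω | Passes f ε β K c ω i}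

lemma tsum_measure_firstPass_le (f : Cube n → Bool) (ε β K : ℝ) (c : Fin n → ℝ) :
    ∑' i, seedMeasure n (firstPass f ε β K c i) ≤ 1 := by
  rw [← MeasureTheory.measure_iUnion]
  · exact MeasureTheory.prob_le_one
  · intro i j hij
    rw [Function.onFun, Set.disjoint_left]
    rintro ω ⟨h1, h2⟩ ⟨h3, h4⟩
    rcases lt_or_gt_of_ne hij with h | h
    · exact h3.2 i h1.1 h h2
    · exact h1.2 j h3.1 h h4
  · exact fun i => (measurableSet_reaches f ε β K c i).inter (measurableSet_passes f ε β K c i)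

/-- The guesses eventually exceed the benchmark, and from then on each further round is reached with
a probability smaller by a factor 8. -/
lemma measure_never_passes (hK : 15 ≤ K) (hε : 0 < ε) (hε2 : ε ≤ 1 / 2) (hβ : 0 < β)
    (hc : ∀ i, 0 ≤ c i) :
    seedMeasure n {ω | ∀ i, 1 ≤ i → ¬ Passes f ε β K c ω i} = 0 := by
  obtain ⟨i₁, hi₁⟩ := pow_unbounded_of_one_lt (optAvg f c ε) (one_lt_two (α := ℝ))
  have herr : ∀ i, i₁ + 1 ≤ i → iprrErr f ε β c i ≤ 2 * ε := fun i hi =>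
    iprrErr_le_of_optAvg_le hε hβ hc
      (hi₁.le.trans (pow_le_pow_right₀ one_le_two (by omega)))
  have hle : ∀ k : ℕ, seedMeasure n {ω | ∀ i, 1 ≤ i → ¬ Passes f ε β K c ω i} ≤
      ENNReal.ofReal (1 / 8) ^ k := by
    intro k
    have h := measure_reaches_le hK hε hε2 (Nat.le_add_left 1 i₁) herr (i₁ + 1 + k)
    rw [Nat.add_sub_cancel_left] at h
    refine (MeasureTheory.measure_mono fun ω hω => ?_).trans h
    exact ⟨by omega, fun i' h1 _ => hω i' h1⟩
  have hlim : Filter.Tendsto (fun k : ℕ => ENNReal.ofReal (1 / 8) ^ k) Filter.atTop (nhds 0) :=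
    ENNReal.tendsto_pow_atTop_nhds_zero_of_lt_one (by
      rw [ENNReal.ofReal_lt_one]; norm_num)
  exact le_antisymm (ge_of_tendsto' hlim hle) zero_le

lemma sum_ofReal_ind_div (p : Cube n → Prop) :
    (∑ x, ENNReal.ofReal (ind (p x))) / 2 ^ n = ENNReal.ofReal (unifPr p) := by
  rw [unifPr_eq_mean, mean, ENNReal.ofReal_div_of_pos (by positivity),
    ENNReal.ofReal_sum_of_nonneg fun _ _ => ind_nonneg _, ENNReal.ofReal_pow (by norm_num)]
  simp

/-- The seed is independent of `x`, so the first passing round `i` contributes its probability times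
the error of IPRR with guess 2^i. Rounds with error at most 12ε are charged to the disjoint events
of passing first; the others are unlikely to pass at all. -/
theorem randError_onlineQuery_le (hK : 15 ≤ K) (hε : 0 < ε) (hε2 : ε ≤ 1 / 2) (hβ : 0 < β)
    (hc : ∀ i, 0 ≤ c i) :
    randError (seedMeasure n) (onlineQuery f ε β K) β c f ≤
      ENNReal.ofReal ((12 + ∑' i : ℕ, 1 / (i : ℝ) ^ 2) * ε) := by
  have hm : ∀ i, 1 ≤ i → 0 < sampleCount K ε i := fun i hi => sampleCount_pos hK hε hε2 hi
  have hx : ∀ x, seedMeasure n {ω | ¬ (onlineQuery f ε β K ω).Outputs β c x (f x)} ≤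
      ∑' i, seedMeasure n (firstPass f ε β K c i) *
        ENNReal.ofReal (ind (iprrOut f ε (2 ^ i) β c x ≠ f x)) := by
    intro x
    have hsub : {ω | ¬ (onlineQuery f ε β K ω).Outputs β c x (f x)} ⊆
        {ω | ∀ i, 1 ≤ i → ¬ Passes f ε β K c ω i} ∪
          ⋃ i, {ω | ω ∈ firstPass f ε β K c i ∧ iprrOut f ε (2 ^ i) β c x ≠ f x} := by
      classical
      intro ω hω
      by_cases hall : ∀ i, 1 ≤ i → ¬ Passes f ε β K c ω i
      · exact Or.inl hall
      · right
        push Not at hall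
        have hspec := Nat.find_spec hall
        have hreach : Reaches f ε β K c ω (Nat.find hall) :=
          ⟨hspec.1, fun i' h1 h2 h3 => Nat.find_min hall h2 ⟨h1, h3⟩⟩
        refine Set.mem_iUnion.2 ⟨Nat.find hall, ⟨hreach, hspec.2⟩, fun heq => hω ?_⟩
        rw [← heq]
        exact oq_outputs hε hβ hm hreach hspec.2
    refine (MeasureTheory.measure_mono hsub).trans ((MeasureTheory.measure_union_le _ _).trans ?_)
    rw [measure_never_passes hK hε hε2 hβ hc, zero_add]
    refine (MeasureTheory.measure_iUnion_le _).trans (ENNReal.tsum_le_tsum fun i => ?_)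
    by_cases h : iprrOut f ε (2 ^ i) β c x ≠ f x
    · rw [ind_of_true h, ENNReal.ofReal_one, mul_one]
      exact MeasureTheory.measure_mono fun ω hω => hω.1
    · rw [ind_of_false h]
      simp [h]
  have hterm : ∀ i, seedMeasure n (firstPass f ε β K c i) * ENNReal.ofReal (iprrErr f ε β c i) ≤
      seedMeasure n (firstPass f ε β K c i) * ENNReal.ofReal (12 * ε) +
        ENNReal.ofReal (ε * (1 / (i : ℝ) ^ 2)) := by
    intro i
    rcases le_total (iprrErr f ε β c i) (12 * ε) with h | h
    · exact le_add_right (by gcongr)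
    · refine le_add_left ?_
      rcases Nat.eq_zero_or_pos i with h0 | h0
      -- Round 0 does not exist, and the term 1/0² is 0, so this event has to be empty.
      · have : firstPass f ε β K c i = ∅ := by
          ext ω
          simp [firstPass, Reaches, h0]
        simp [this]
      · refine le_trans ?_ (measure_passes_le hK hε hε2 h0 h)
        refine (mul_le_of_le_one_right zero_le ?_).trans
          (MeasureTheory.measure_mono Set.inter_subset_right)
        exact ENNReal.ofReal_le_one.2 (unifPr_le_one _)
  have hsum : Summable fun i : ℕ => 1 / (i : ℝ) ^ 2 := Real.summable_one_div_nat_pow.2 one_lt_two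
  unfold randError
  calc _ ≤ (∑ x, ∑' i, seedMeasure n (firstPass f ε β K c i) *
          ENNReal.ofReal (ind (iprrOut f ε (2 ^ i) β c x ≠ f x))) / 2 ^ n := by
        gcongr with x; exact hx x
    _ = ∑' i, seedMeasure n (firstPass f ε β K c i) * ENNReal.ofReal (iprrErr f ε β c i) := by
        rw [← Summable.tsum_finsetSum fun _ _ => ENNReal.summable, div_eq_mul_inv,
          ← ENNReal.tsum_mul_right]
        refine tsum_congr fun i => ?_
        rw [← Finset.mul_sum, mul_assoc, ← div_eq_mul_inv, sum_ofReal_ind_div]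
        rfl
    _ ≤ ∑' i, (seedMeasure n (firstPass f ε β K c i) * ENNReal.ofReal (12 * ε) +
        ENNReal.ofReal (ε * (1 / (i : ℝ) ^ 2))) := ENNReal.tsum_le_tsum hterm
    _ ≤ ENNReal.ofReal (12 * ε) + ENNReal.ofReal (ε * ∑' i : ℕ, 1 / (i : ℝ) ^ 2) := by
        rw [ENNReal.tsum_add, ENNReal.tsum_mul_right, ← tsum_mul_left,
          ENNReal.ofReal_tsum_of_nonneg (fun i => by positivity) (hsum.mul_left ε)]
        gcongr
        exact mul_le_of_le_one_left zero_le (tsum_measure_firstPass_le f ε β K c)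
    _ = _ := by
        rw [← ENNReal.ofReal_add (by positivity)
          (mul_nonneg hε.le (tsum_nonneg fun i => by positivity))]
        congr 1; ring

end Concentration

/-! ### The cost of Online-Query -/

section Cost

variable {n : ℕ} {f : Cube n → Bool} {ε β K : ℝ} {c : Fin n → ℝ}

lemma sum_div_eq_lintegral (g : Cube n → ℝ≥0∞) :
    (∑ x, g x) / 2 ^ n = ∫⁻ x, g x ∂(PMF.uniformOfFintype (Cube n)).toMeasure := by
  rw [MeasureTheory.lintegral_fintype, div_eq_mul_inv, Finset.sum_mul]
  refine Finset.sum_congr rfl fun x _ => ?_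
  rw [PMF.toMeasure_apply_singleton _ _ (MeasurableSet.singleton x)]
  simp

/-- A measurable bound for the `i`-th term of `callBound`. -/
noncomputable def roundBound (f : Cube n → Bool) (ε β K : ℝ) (c : Fin n → ℝ) (i₀ : ℕ)
    (j : Fin n) (i : ℕ) (x : Cube n) (ω : Seed n) : ℝ≥0∞ :=
  ENNReal.ofReal (2 ^ i / ε) * (∑ l ∈ Finset.range (sampleCount K ε i),
    roundProd (Finset.Ico i₀ i) (sampleCount K ε) (upperWeight f ε β c) ω *
      ENNReal.ofReal (maxInf f ε (2 ^ i) β c j (ω (i, l))) +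
    roundProd (Finset.Ico i₀ i) (sampleCount K ε) (upperWeight f ε β c) ω *
      ENNReal.ofReal (maxInf f ε (2 ^ i) β c j x))

lemma measurable_roundBound (i₀ : ℕ) (j : Fin n) (i : ℕ) (x : Cube n) :
    Measurable (roundBound f ε β K c i₀ j i x) := by
  unfold roundBound
  have h := measurable_roundProd (Finset.Ico i₀ i) (sampleCount K ε) (upperWeight f ε β c)
  refine Measurable.const_mul (Measurable.add ?_ (h.mul_const _)) _
  exact Finset.measurable_fun_sum _ fun l _ => h.mul
    (measurable_sample (fun y => ENNReal.ofReal (maxInf f ε (2 ^ i) β c j y)) (i, l))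

lemma callBound_le (hm : ∀ i, 1 ≤ i → 0 < sampleCount K ε i) {i₀ : ℕ} (hi₀ : 1 ≤ i₀)
    (ω : Seed n) (x : Cube n) (j : Fin n) :
    callBound f ε β K c ω x j ≤ ∑' i, roundBound f ε β K c i₀ j i x ω := by
  unfold callBound
  refine ENNReal.tsum_le_tsum fun i => ?_
  split_ifs with h
  · have h1 := one_le_roundProd_of_reaches hm hi₀ h
    unfold roundBound
    gcongr with l
    · exact le_mul_of_one_le_left zero_le h1
    · exact le_mul_of_one_le_left zero_le h1
  · exact zero_le

/-- The weight involves only rounds before `i`, so it is independent of the samples whose maximal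
influence is charged in round `i`. -/
lemma lintegral_roundBound_le (hK : 15 ≤ K) (hε : 0 < ε) (hε2 : ε ≤ 1 / 2) {i₀ : ℕ}
    (hi₀ : 1 ≤ i₀) (h : ∀ i, i₀ ≤ i → iprrErr f ε β c i ≤ 2 * ε) (j : Fin n) (i : ℕ)
    (x : Cube n) :
    ∫⁻ ω, roundBound f ε β K c i₀ j i x ω ∂seedMeasure n ≤
      ENNReal.ofReal (2 ^ i / ε) * (ENNReal.ofReal (1 / 8) ^ (i - i₀) *
        (sampleCount K ε i * ENNReal.ofReal (mean (maxInf f ε (2 ^ i) β c j)) +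
          ENNReal.ofReal (maxInf f ε (2 ^ i) β c j x))) := by
  have hD := measurable_roundProd (Finset.Ico i₀ i) (sampleCount K ε) (upperWeight f ε β c)
  have hP := prod_pow_mean_upperWeight_le hK hε hε2 hi₀ h i
  have hmeas : ∀ l, Measurable fun ω : Seed n =>
      roundProd (Finset.Ico i₀ i) (sampleCount K ε) (upperWeight f ε β c) ω *
        ENNReal.ofReal (maxInf f ε (2 ^ i) β c j (ω (i, l))) := fun l => hD.mul
    (measurable_sample (fun y => ENNReal.ofReal (maxInf f ε (2 ^ i) β c j y)) (i, l))
  have h1 : ∀ l, ∫⁻ ω,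
      roundProd (Finset.Ico i₀ i) (sampleCount K ε) (upperWeight f ε β c) ω *
        ENNReal.ofReal (maxInf f ε (2 ^ i) β c j (ω (i, l))) ∂seedMeasure n =
      (∏ i' ∈ Finset.Ico i₀ i, ENNReal.ofReal (mean (upperWeight f ε β c i')) ^
        sampleCount K ε i') * ENNReal.ofReal (mean (maxInf f ε (2 ^ i) β c j)) := fun l =>
    lintegral_roundProd_mul (Finset.Ico i₀ i) (sampleCount K ε) (upperWeight_nonneg f ε β c)
      (h := maxInf f ε (2 ^ i) β c j) (fun y => maxInf_nonneg j) (k := (i, l))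
      Finset.right_notMem_Ico
  have h2 := lintegral_roundProd (Finset.Ico i₀ i) (sampleCount K ε) (upperWeight_nonneg f ε β c)
  unfold roundBound
  generalize roundProd (Finset.Ico i₀ i) (sampleCount K ε) (upperWeight f ε β c) = D at *
  generalize (∏ i' ∈ Finset.Ico i₀ i, ENNReal.ofReal (mean (upperWeight f ε β c i')) ^
        sampleCount K ε i') = p at *
  rw [MeasureTheory.lintegral_const_mul' _ _ ENNReal.ofReal_ne_top]
  refine mul_le_mul_right ?_ _
  rw [MeasureTheory.lintegral_add_right _ (hD.mul_const _),
    MeasureTheory.lintegral_finsetSum _ fun l _ => hmeas l,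
    MeasureTheory.lintegral_mul_const _ hD, h2]
  simp_rw [h1]
  rw [Finset.sum_const, Finset.card_range, nsmul_eq_mul, mul_left_comm, ← mul_add]
  exact mul_le_mul_left hP _

/-- The average cost of Online-Query, as a sum over the rounds. -/
lemma randAvgCost_le_tsum (hK : 15 ≤ K) (hε : 0 < ε) (hε2 : ε ≤ 1 / 2) (hβ : 0 < β) {i₀ : ℕ}
    (hi₀ : 1 ≤ i₀) (h : ∀ i, i₀ ≤ i → iprrErr f ε β c i ≤ 2 * ε) :
    randAvgCost (seedMeasure n) (onlineQuery f ε β K) β c ≤ ENNReal.ofReal (β * n) +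
      (∑' i : ℕ, ENNReal.ofReal (2 ^ i / ε) * (ENNReal.ofReal (1 / 8) ^ (i - i₀) *
        (sampleCount K ε i + 1))) *
      ENNReal.ofReal (∑ j, influence f j * (1 + Real.log (1 / influence f j))) := by
  have hm : ∀ i, 1 ≤ i → 0 < sampleCount K ε i := fun i hi => sampleCount_pos hK hε hε2 hi
  set M : ℕ → Fin n → Cube n → ℝ := fun i j => maxInf f ε (2 ^ i) β c j with hM
  set S : Fin n → ℝ := fun j => influence f j * (1 + Real.log (1 / influence f j)) with hS
  have hMS : ∀ i j, mean (M i j) ≤ S j := fun i j => mean_maxInf_le f c hε (by positivity) hβ j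
  have hM0 : ∀ i j, 0 ≤ mean (M i j) := fun i j => mean_nonneg fun y => maxInf_nonneg j
  have hx : ∀ x, ∫⁻ ω, (onlineQuery f ε β K ω).cost β c x ∂seedMeasure n ≤
      ENNReal.ofReal (β * n) + ∑ j, ∑' i : ℕ, ENNReal.ofReal (2 ^ i / ε) *
        (ENNReal.ofReal (1 / 8) ^ (i - i₀) * (sampleCount K ε i * ENNReal.ofReal (mean (M i j)) +
          ENNReal.ofReal (M i j x))) := by
    intro x
    calc _ ≤ ∫⁻ ω, (ENNReal.ofReal (β * n) +
            ∑ j, ∑' i, roundBound f ε β K c i₀ j i x ω) ∂seedMeasure n := by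
          refine MeasureTheory.lintegral_mono fun ω => (oq_cost_le hε hβ hm).trans ?_
          gcongr with j
          exact callBound_le hm hi₀ ω x j
      _ = ENNReal.ofReal (β * n) + ∑ j, ∑' i,
            ∫⁻ ω, roundBound f ε β K c i₀ j i x ω ∂seedMeasure n := by
          rw [MeasureTheory.lintegral_add_left measurable_const,
            MeasureTheory.lintegral_finsetSum _ fun j _ =>
              Measurable.tsum fun i => measurable_roundBound i₀ j i x]
          simp only [MeasureTheory.lintegral_const, MeasureTheory.measure_univ, mul_one]
          congr 1
          refine Finset.sum_congr rfl fun j _ => ?_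
          exact MeasureTheory.lintegral_tsum fun i => (measurable_roundBound i₀ j i x).aemeasurable
      _ ≤ _ := by
          gcongr with j _ i
          exact lintegral_roundBound_le hK hε hε2 hi₀ h j i x
  unfold randAvgCost
  rw [sum_div_eq_lintegral]
  calc _ ≤ ∫⁻ x, (ENNReal.ofReal (β * n) + ∑ j, ∑' i : ℕ, ENNReal.ofReal (2 ^ i / ε) *
        (ENNReal.ofReal (1 / 8) ^ (i - i₀) * (sampleCount K ε i * ENNReal.ofReal (mean (M i j)) +
          ENNReal.ofReal (M i j x)))) ∂(PMF.uniformOfFintype (Cube n)).toMeasure :=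
        MeasureTheory.lintegral_mono hx
    _ = ENNReal.ofReal (β * n) + ∑ j, ∑' i : ℕ, ENNReal.ofReal (2 ^ i / ε) *
        (ENNReal.ofReal (1 / 8) ^ (i - i₀) * ((sampleCount K ε i + 1) *
          ENNReal.ofReal (mean (M i j)))) := by
        rw [MeasureTheory.lintegral_add_left measurable_const,
          MeasureTheory.lintegral_finsetSum _ fun j _ => Measurable.of_discrete]
        simp only [MeasureTheory.lintegral_const, MeasureTheory.measure_univ, mul_one]
        congr 1
        refine Finset.sum_congr rfl fun j _ => ?_
        rw [MeasureTheory.lintegral_tsum fun i => Measurable.of_discrete.aemeasurable]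
        refine tsum_congr fun i => ?_
        rw [MeasureTheory.lintegral_const_mul _ Measurable.of_discrete,
          MeasureTheory.lintegral_const_mul _ Measurable.of_discrete,
          MeasureTheory.lintegral_add_left measurable_const,
          lintegral_uniform_ofReal fun y => maxInf_nonneg j]
        simp only [MeasureTheory.lintegral_const, MeasureTheory.measure_univ, mul_one]
        rw [add_mul, one_mul]
    _ ≤ ENNReal.ofReal (β * n) + ∑ j, ∑' i : ℕ, ENNReal.ofReal (2 ^ i / ε) *
        (ENNReal.ofReal (1 / 8) ^ (i - i₀) * ((sampleCount K ε i + 1) *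
          ENNReal.ofReal (S j))) := by
        gcongr with j _ i
        exact hMS i j
    _ = _ := by
        rw [ENNReal.ofReal_sum_of_nonneg fun j _ => (hM0 0 j).trans (hMS 0 j), Finset.mul_sum]
        congr 1
        refine Finset.sum_congr rfl fun j _ => ?_
        rw [← ENNReal.tsum_mul_right]
        refine tsum_congr fun i => ?_
        ring

/-! ### Summation over the rounds -/

/-- With truncated subtraction the exponent is |i − i₀|. -/
lemma summable_two_sided (i₀ : ℕ) :
    Summable fun i : ℕ => ((1 : ℝ) / 2) ^ ((i₀ - i) + (i - i₀)) := by
  rw [← summable_nat_add_iff i₀]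
  refine summable_geometric_two.congr fun k => ?_
  congr 1
  omega

lemma tsum_two_sided_le (i₀ : ℕ) :
    ∑' i : ℕ, ((1 : ℝ) / 2) ^ ((i₀ - i) + (i - i₀)) ≤ 4 := by
  rw [← (summable_two_sided i₀).sum_add_tsum_nat_add i₀]
  have h1 : ∑' k : ℕ, ((1 : ℝ) / 2) ^ ((i₀ - (k + i₀)) + (k + i₀ - i₀)) = 2 := by
    refine (tsum_congr fun k => ?_).trans tsum_geometric_two
    congr 1
    omega
  have h2 : ∑ i ∈ Finset.range i₀, ((1 : ℝ) / 2) ^ ((i₀ - i) + (i - i₀)) ≤ 2 := by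
    rw [← Finset.sum_range_reflect]
    refine le_trans ?_ (sum_geometric_two_le i₀)
    refine Finset.sum_le_sum fun k hk => ?_
    have := Finset.mem_range.1 hk
    exact pow_le_pow_of_le_one (by norm_num) (by norm_num) (by omega)
  linarith

/-- With k = i − i₀ truncated, i ≤ 2^k·i₀, so the logarithm grows by at most k. As log(i₀/ε) ≥ 1,
this is absorbed by the factor 2^k. -/
lemma logb_div_le (hε : 0 < ε) (hε2 : ε ≤ 1 / 2) {i₀ i : ℕ} (hi₀ : 1 ≤ i₀) (hi : 1 ≤ i) :
    Real.logb 2 (i / ε) ≤ 2 ^ (i - i₀) * Real.logb 2 (i₀ / ε) := by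
  have h1 := one_le_logb hε hε2 hi₀
  have hi₀' : (1 : ℝ) ≤ i₀ := by exact_mod_cast hi₀
  have hi' : (1 : ℝ) ≤ i := by exact_mod_cast hi
  have hk : ((i - i₀ : ℕ) : ℝ) + 1 ≤ 2 ^ (i - i₀) := by
    exact_mod_cast Nat.lt_two_pow_self (n := i - i₀)
  have h2 : (i : ℝ) ≤ 2 ^ (i - i₀) * i₀ := by
    have : (i : ℝ) ≤ (i - i₀ : ℕ) + i₀ := by exact_mod_cast (by omega : i ≤ (i - i₀) + i₀)
    nlinarith [Nat.cast_nonneg (α := ℝ) (i - i₀)]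
  calc Real.logb 2 (i / ε) ≤ Real.logb 2 (2 ^ (i - i₀) * (i₀ / ε)) := by
        refine Real.logb_le_logb_of_le (by norm_num) (by positivity) ?_
        rw [← mul_div_assoc]
        gcongr
    _ = (i - i₀ : ℕ) + Real.logb 2 (i₀ / ε) := by
        rw [Real.logb_mul (by positivity) (by positivity), Real.logb_pow, Real.logb_self_eq_one
          (by norm_num), mul_one]
    _ ≤ _ := by nlinarith [Nat.cast_nonneg (α := ℝ) (i - i₀)]

/-- The 2 in `K + 2` absorbs the rounding up and the one call on the unknown input. -/
lemma sampleCount_add_one_le (hK : 15 ≤ K) (hε : 0 < ε) (hε2 : ε ≤ 1 / 2) {i₀ : ℕ} (hi₀ : 1 ≤ i₀)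
    (i : ℕ) : (sampleCount K ε i : ℝ) + 1 ≤
      (K + 2) / ε * (2 ^ (i - i₀) * Real.logb 2 (i₀ / ε)) := by
  have h1 := one_le_logb hε hε2 hi₀
  have hε1 : 1 ≤ 1 / ε := by rw [le_div_iff₀ hε]; linarith
  have hpow : (1 : ℝ) ≤ 2 ^ (i - i₀) := one_le_pow₀ (by norm_num)
  have hX : 1 ≤ 2 ^ (i - i₀) * Real.logb 2 (i₀ / ε) := one_le_mul_of_one_le_of_one_le hpow h1
  have hlog : Real.logb 2 (i / ε) ≤ 2 ^ (i - i₀) * Real.logb 2 (i₀ / ε) := by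
    rcases Nat.eq_zero_or_pos i with h0 | h0
    · rw [h0]; simp; linarith
    · exact logb_div_le hε hε2 hi₀ h0
  have hceil : (sampleCount K ε i : ℝ) ≤
      K / ε * (2 ^ (i - i₀) * Real.logb 2 (i₀ / ε)) + 1 := by
    have hnn : 0 ≤ K / ε * (2 ^ (i - i₀) * Real.logb 2 (i₀ / ε)) := by positivity
    refine le_trans ?_ (Nat.ceil_lt_add_one hnn).le
    unfold sampleCount
    exact_mod_cast Nat.ceil_mono (mul_le_mul_of_nonneg_left hlog (by positivity))
  have h2 : 1 ≤ 1 / ε * (2 ^ (i - i₀) * Real.logb 2 (i₀ / ε)) :=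
    one_le_mul_of_one_le_of_one_le hε1 hX
  have h3 : (K + 2) / ε * (2 ^ (i - i₀) * Real.logb 2 (i₀ / ε)) =
      K / ε * (2 ^ (i - i₀) * Real.logb 2 (i₀ / ε)) +
        2 * (1 / ε * (2 ^ (i - i₀) * Real.logb 2 (i₀ / ε))) := by ring
  linarith

/-- After round i₀ the terms are bounded geometrically with ratio 2·2/8 = 1/2; before it the guess
2^i alone gives geometric decay. -/
lemma tsum_rounds_le (hK : 15 ≤ K) (hε : 0 < ε) (hε2 : ε ≤ 1 / 2) {i₀ : ℕ} (hi₀ : 1 ≤ i₀) :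
    (∑' i : ℕ, ENNReal.ofReal (2 ^ i / ε) * (ENNReal.ofReal (1 / 8) ^ (i - i₀) *
        (sampleCount K ε i + 1))) ≤
      ENNReal.ofReal (4 * (K + 2) * 2 ^ i₀ * (1 / ε ^ 2) * Real.logb 2 (i₀ / ε)) := by
  have h1 := one_le_logb hε hε2 hi₀
  set G : ℝ := (K + 2) * 2 ^ i₀ * (1 / ε ^ 2) * Real.logb 2 (i₀ / ε) with hG
  have hG0 : 0 ≤ G := by positivity
  calc _ ≤ ∑' i : ℕ, ENNReal.ofReal (G * (1 / 2) ^ ((i₀ - i) + (i - i₀))) := by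
        refine ENNReal.tsum_le_tsum fun i => ?_
        have h2 : (sampleCount K ε i + 1 : ℝ≥0∞) =
            ENNReal.ofReal ((sampleCount K ε i : ℝ) + 1) := by
          rw [ENNReal.ofReal_add (by positivity) zero_le_one]; simp
        rw [h2, ← ENNReal.ofReal_pow (by norm_num), ← ENNReal.ofReal_mul (by positivity),
          ← ENNReal.ofReal_mul (by positivity)]
        refine ENNReal.ofReal_le_ofReal ?_
        have h3 := sampleCount_add_one_le hK hε hε2 hi₀ i
        calc _ ≤ 2 ^ i / ε * ((1 / 8) ^ (i - i₀) *
              ((K + 2) / ε * (2 ^ (i - i₀) * Real.logb 2 (i₀ / ε)))) := by gcongr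
          _ = _ := by
              have h4 : (2 : ℝ) ^ i = 2 ^ i₀ * 2 ^ (i - i₀) * (1 / 2) ^ (i₀ - i) := by
                rw [one_div, inv_pow, eq_mul_inv_iff_mul_eq₀ (by positivity), ← pow_add, ← pow_add]
                congr 1; omega
              have h5 : ((1 : ℝ) / 2) ^ (i - i₀) =
                  2 ^ (i - i₀) * ((1 / 8) ^ (i - i₀) * 2 ^ (i - i₀)) := by
                rw [← mul_pow, ← mul_pow]; norm_num
              rw [pow_add, h5, h4, hG]
              field_simp
    _ = ENNReal.ofReal (G * ∑' i : ℕ, (1 / 2) ^ ((i₀ - i) + (i - i₀))) := by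
        rw [← tsum_mul_left, ENNReal.ofReal_tsum_of_nonneg (fun i => by positivity)
          ((summable_two_sided i₀).mul_left G)]
    _ ≤ _ := by
        refine ENNReal.ofReal_le_ofReal ?_
        calc _ ≤ G * 4 := mul_le_mul_of_nonneg_left (tsum_two_sided_le i₀) hG0
          _ = _ := by rw [hG]; ring

/-- The first round whose guess exceeds the benchmark. -/
lemma exists_first_good_round {a o : ℝ} (ha : 0 < a) (hao : a ≤ o) :
    ∃ i₀ : ℕ, 1 ≤ i₀ ∧ o ≤ 2 ^ i₀ ∧ 2 ^ i₀ ≤ (2 / a + 2) * o ∧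
      (i₀ : ℝ) ≤ 2 * max 1 (Real.logb 2 o) := by
  have ho : 0 < o := ha.trans_le hao
  rcases le_total o 2 with h | h
  · refine ⟨1, le_rfl, by simpa using h, ?_, ?_⟩
    -- The only use of the lower bound `a`: the guesses start at 2, which must be O(opt) even for
    -- small opt.
    · have : 2 ≤ 2 / a * o := by
        rw [div_mul_eq_mul_div, le_div_iff₀ ha]; linarith
      rw [add_mul, pow_one]; linarith
    · have := le_max_left 1 (Real.logb 2 o)
      norm_num; linarith
  · have hl : 1 ≤ Real.logb 2 o := by
      rw [Real.le_logb_iff_rpow_le (by norm_num) ho, Real.rpow_one]; exact h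
    have hpow : (2 : ℝ) ^ Real.logb 2 o = o := Real.rpow_logb (by norm_num) (by norm_num) ho
    have hub := Nat.ceil_lt_add_one (zero_le_one.trans hl)
    have hlb := Nat.le_ceil (Real.logb 2 o)
    refine ⟨⌈Real.logb 2 o⌉₊, ?_, ?_, ?_, ?_⟩
    · exact Nat.one_le_ceil_iff.2 (zero_lt_one.trans_le hl)
    · rw [← Real.rpow_natCast]
      calc o = (2 : ℝ) ^ Real.logb 2 o := hpow.symm
        _ ≤ _ := Real.rpow_le_rpow_of_exponent_le (by norm_num) hlb
    · rw [← Real.rpow_natCast]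
      calc (2 : ℝ) ^ ((⌈Real.logb 2 o⌉₊ : ℕ) : ℝ) ≤ (2 : ℝ) ^ (Real.logb 2 o + 1) :=
            Real.rpow_le_rpow_of_exponent_le (by norm_num) hub.le
        _ = o * 2 := by rw [Real.rpow_add (by norm_num), hpow, Real.rpow_one]
        _ ≤ _ := by
            have : 0 ≤ 2 / a * o := by positivity
            linarith
    · have := le_max_right 1 (Real.logb 2 o)
      linarith

lemma one_le_logFactor (hε : 0 < ε) (hε2 : ε ≤ 1 / 2) (o : ℝ) : 1 ≤ logFactor o ε := by
  unfold logFactor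
  have h := le_max_left 1 (Real.logb 2 o)
  rw [Real.le_logb_iff_rpow_le (by norm_num) (by positivity), Real.rpow_one, le_div_iff₀ hε]
  linarith

lemma logb_round_le (hε : 0 < ε) (hε2 : ε ≤ 1 / 2) {o : ℝ} {i₀ : ℕ} (hi₀ : 1 ≤ i₀)
    (h : (i₀ : ℝ) ≤ 2 * max 1 (Real.logb 2 o)) :
    Real.logb 2 (i₀ / ε) ≤ 2 * logFactor o ε := by
  have h1 := one_le_logFactor hε hε2 o
  have hmax := le_max_left 1 (Real.logb 2 o)
  have hi₀' : (1 : ℝ) ≤ i₀ := by exact_mod_cast hi₀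
  calc Real.logb 2 (i₀ / ε) ≤ Real.logb 2 (2 * (max 1 (Real.logb 2 o) / ε)) := by
        refine Real.logb_le_logb_of_le (by norm_num) (by positivity) ?_
        rw [← mul_div_assoc]; gcongr
    _ = 1 + logFactor o ε := by
        rw [Real.logb_mul (by norm_num) (by positivity), Real.logb_self_eq_one (by norm_num),
          logFactor]
    _ ≤ _ := by linarith

lemma influence_mul_log_nonneg (f : Cube n → Bool) :
    0 ≤ ∑ j, influence f j * (1 + Real.log (1 / influence f j)) := by
  refine Finset.sum_nonneg fun j _ => ?_
  rcases (influence_nonneg f j).eq_or_lt with h | h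
  · rw [← h, zero_mul]
  · have : 0 ≤ Real.log (1 / influence f j) :=
      Real.log_nonneg (by rw [le_div_iff₀ h]; linarith [influence_le_one f j])
    positivity

/-- The average cost of Online-Query in terms of the benchmark. -/
theorem randAvgCost_le (hK : 15 ≤ K) (hε : 0 < ε) (hε2 : ε ≤ 1 / 2) (hβ : 0 < β)
    (hc : ∀ i, 0 ≤ c i) {a : ℝ} (ha : 0 < a) (hopt : a ≤ optAvg f c ε) :
    randAvgCost (seedMeasure n) (onlineQuery f ε β K) β c ≤ ENNReal.ofReal (β * n +
      8 * (K + 2) * (2 / a + 2) * optAvg f c ε * (1 / ε ^ 2 * logFactor (optAvg f c ε) ε) *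
        ∑ j, influence f j * (1 + Real.log (1 / influence f j))) := by
  obtain ⟨i₀, hi₀, h1, h2, h3⟩ := exists_first_good_round ha hopt
  have herr : ∀ i, i₀ ≤ i → iprrErr f ε β c i ≤ 2 * ε := fun i hi =>
    iprrErr_le_of_optAvg_le hε hβ hc (h1.trans (pow_le_pow_right₀ one_le_two hi))
  have hS := influence_mul_log_nonneg f
  have ho : 0 < optAvg f c ε := ha.trans_le hopt
  have hlf := one_le_logFactor hε hε2 (optAvg f c ε)
  have hl := logb_round_le hε hε2 hi₀ h3
  have hl0 := one_le_logb hε hε2 hi₀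
  refine (randAvgCost_le_tsum hK hε hε2 hβ hi₀ herr).trans ?_
  rw [ENNReal.ofReal_add (by positivity) (by positivity)]
  gcongr
  rw [ENNReal.ofReal_mul (by positivity)]
  gcongr
  refine (tsum_rounds_le hK hε hε2 hi₀).trans (ENNReal.ofReal_le_ofReal ?_)
  calc _ ≤ 4 * (K + 2) * ((2 / a + 2) * optAvg f c ε) * (1 / ε ^ 2) *
        (2 * logFactor (optAvg f c ε) ε) := by gcongr
    _ = _ := by ring

/-- The entropy-like sum in terms of the total influence. -/
lemma sum_influence_log_le (hε : 0 < ε) (hε2 : ε ≤ 1 / 2) (hn : 2 ≤ n)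
    (hI : ε < totalInfluence f) :
    ∑ j, influence f j * (1 + Real.log (1 / influence f j)) ≤
      2 * (totalInfluence f * Real.logb 2 n / ε) := by
  set I := totalInfluence f with hIdef
  have hI0 : 0 < I := hε.trans hI
  have hn' : (2 : ℝ) ≤ n := by exact_mod_cast hn
  have hn0 : (0 : ℝ) < n := by linarith
  have hterm : ∀ j, influence f j * (1 + Real.log (1 / influence f j)) ≤
      influence f j * Real.log (n / I) + I / n := by
    intro j
    rcases (influence_nonneg f j).eq_or_lt with h | h
    · rw [← h]; simp; positivity
    -- The tangent bound ln t ≤ t − 1 compares the influence with the average I/n, as in the proof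
    -- that entropy is largest for the uniform distribution.
    · have h1 := Real.log_le_sub_one_of_pos (x := I / n / influence f j) (by positivity)
      rw [Real.log_div (by positivity) h.ne', Real.log_div hI0.ne' hn0.ne'] at h1
      rw [one_div, Real.log_inv, Real.log_div hn0.ne' hI0.ne']
      have h2 := mul_le_mul_of_nonneg_left h1 h.le
      have h3 : influence f j * (I / n / influence f j - 1) = I / n - influence f j := by
        field_simp
      rw [h3] at h2
      linarith
  have hsum : ∑ j, influence f j * (1 + Real.log (1 / influence f j)) ≤
      I * Real.log (n / I) + I := by
    refine (Finset.sum_le_sum fun j _ => hterm j).trans (le_of_eq ?_)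
    rw [Finset.sum_add_distrib, ← Finset.sum_mul, hIdef, totalInfluence]
    simp
    field_simp
  have hlog2 : Real.log n ≤ Real.logb 2 n := by
    rw [Real.logb, le_div_iff₀ (Real.log_pos (by norm_num))]
    have h1 : 0 ≤ Real.log n := Real.log_nonneg (by linarith)
    have h2 : Real.log 2 ≤ 1 := by linarith [Real.log_two_lt_d9]
    nlinarith
  have hlogn : 1 ≤ Real.logb 2 n := by
    rw [Real.le_logb_iff_rpow_le (by norm_num) hn0, Real.rpow_one]; exact hn'
  -- Small total influence costs at most ln(1/ε) ≤ 1/ε − 1; this is where the extra factor 1/ε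
  -- enters.
  have hlogI : -Real.log I ≤ 1 / ε - 1 := by
    have h1 := Real.log_le_log hε hI.le
    have h2 := Real.log_le_sub_one_of_pos (x := 1 / ε) (by positivity)
    rw [one_div, Real.log_inv] at h2
    rw [one_div]
    linarith
  have hI1 : Real.log (n / I) + 1 ≤ Real.logb 2 n + 1 / ε := by
    rw [Real.log_div hn0.ne' hI0.ne']; linarith
  have hε1 : 1 ≤ 1 / ε := by rw [le_div_iff₀ hε]; linarith
  have h1 : Real.logb 2 n + 1 / ε ≤ 2 * (Real.logb 2 n * (1 / ε)) := by nlinarith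
  calc _ ≤ I * (Real.log (n / I) + 1) := by linarith
    _ ≤ I * (2 * (Real.logb 2 n * (1 / ε))) :=
        mul_le_mul_of_nonneg_left (hI1.trans h1) hI0.le
    _ = _ := by ring

end Cost

end PricedQuery

/-! ### Proof of the theorem -/

open PricedQuery

theorem theorem4p1 :
    ∃ K₀ : ℝ, 0 < K₀ ∧ ∀ K : ℝ, K₀ ≤ K →
      (∃ C : ℝ, 0 < C ∧
        ∀ (n : ℕ) (f : Cube n → Bool) (c : Fin n → ℝ) (ε β : ℝ),
          (∀ i, 0 ≤ c i) → 0 < ε → ε ≤ 1 / 2 → 0 < β →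
          randError (seedMeasure n) (onlineQuery f ε β K) β c f ≤ ENNReal.ofReal (C * ε)) ∧
      (∀ a : ℝ, 0 < a → ∃ C : ℝ, 0 < C ∧
        ∀ (n : ℕ) (f : Cube n → Bool) (c : Fin n → ℝ) (ε β : ℝ),
          (∀ i, 0 ≤ c i) → 0 < ε → ε ≤ 1 / 2 → 0 < β → a ≤ optAvg f c ε →
          randAvgCost (seedMeasure n) (onlineQuery f ε β K) β c ≤
            ENNReal.ofReal (β * n + optAvg f c ε *
              (C * (1 / ε ^ 3 * logFactor (optAvg f c ε) ε)) *
                ∑ i, influence f i * (1 + Real.log (1 / influence f i))) ∧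
          (2 ≤ n →
            randAvgCost (seedMeasure n) (onlineQuery f ε β K) β c ≤
              ENNReal.ofReal (β * n + optAvg f c ε *
                (C * (totalInfluence f * Real.logb 2 n / ε ^ 3 *
                  logFactor (optAvg f c ε) ε))))) := by
  refine ⟨15, by norm_num, fun K hK => ⟨⟨12 + ∑' i : ℕ, 1 / (i : ℝ) ^ 2, ?_, ?_⟩, fun a ha =>
    -- Twice the constant of `randAvgCost_le`; the 2 comes from `sum_influence_log_le`.
    ⟨16 * (K + 2) * (2 / a + 2), by positivity, ?_⟩⟩⟩
  · have : 0 ≤ ∑' i : ℕ, 1 / (i : ℝ) ^ 2 := tsum_nonneg fun i => by positivity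
    linarith
  · intro n f c ε β hc hε hε2 hβ
    exact randError_onlineQuery_le hK hε hε2 hβ hc
  · intro n f c ε β hc hε hε2 hβ hopt
    have ho : 0 < optAvg f c ε := ha.trans_le hopt
    have hlf := one_le_logFactor hε hε2 (optAvg f c ε)
    have hS := influence_mul_log_nonneg f
    have hcost := randAvgCost_le hK hε hε2 hβ hc ha hopt
    -- The first bound holds with ε⁻² and is merely weakened here.
    have hε3 : 1 / ε ^ 2 ≤ 1 / ε ^ 3 :=
      one_div_le_one_div_of_le (by positivity)
        (pow_le_pow_of_le_one hε.le (by linarith) (by norm_num))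
    refine ⟨hcost.trans (ENNReal.ofReal_le_ofReal ?_), fun hn =>
      hcost.trans (ENNReal.ofReal_le_ofReal ?_)⟩
    · calc _ ≤ β * n + 16 * (K + 2) * (2 / a + 2) * optAvg f c ε *
            (1 / ε ^ 3 * logFactor (optAvg f c ε) ε) *
              ∑ j, influence f j * (1 + Real.log (1 / influence f j)) := by
            gcongr; norm_num
        _ = _ := by ring
    · have hent := sum_influence_log_le hε hε2 hn (lt_totalInfluence_of_optAvg_pos f hc ho)
      calc _ ≤ β * n + 8 * (K + 2) * (2 / a + 2) * optAvg f c ε *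
            (1 / ε ^ 2 * logFactor (optAvg f c ε) ε) *
              (2 * (totalInfluence f * Real.logb 2 n / ε)) := by gcongr
        _ = _ := by field_simp; ring
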